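/- Setting. Let $\mathcal X$ be a measurable space, let $\mathcal Z=\mathcal X\times[0,1]$, and let $\mathcal H$ be a class of functions $\mathcal X\to\mathbb R$ that is permissible: it can be written as $\{g(\theta,\cdot):\theta\in\Theta\}$ with $\Theta$ a standard Borel space and $g:\Theta\times\mathcal X\to\mathbb R$ jointly measurable. The pseudodimension of $\mathcal H$ is the largest $m$ for which there are $x_1,\dots,x_m\in\mathcal X$ and $y_1,\dots,y_m\in\mathbb R$ such that for every $b\in\{0,1\}^m$ some $h\in\mathcal H$ satisfies $h(x_i)>y_i\Leftrightarrow b_i=1$ for all $i$. A squared error regression oracle for $\mathcal H$ is a map $A_{\mathcal H}$ that sends every probability distribution $\mathcal D$ on $\mathcal Z$ to some $h\in\mathcal H$ minimizing $\mathbb E_{(x,y)\sim\mathcal D}[(h(x)-y)^2]\in[0,\infty]$ over $\mathcal H$. Algorithm LSBoost$(f,\alpha,A_{\mathcal H},\mathcal D,B)$. Let $m=\lceil 2B/\alpha\rceil$, let $[1/m]=\{0,\frac1m,\dots,1\}$, and let $\mathrm{Round}$ denote pointwise rounding to the nearest point of $[1/m]$ (ties are rounded up). Put $f_0=\mathrm{Round}(f)$.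 For $t=0,1,2,\dots$, choose for each $v\in[1/m]$ a function $h_v^{t+1}\in\mathcal H$, namely $h^{t+1}_v=A_{\mathcal H}(\mathcal D\mid f_t(x)=v)$ if $\Pr_{\mathcal D}[f_t(x)=v]>0$ (and an arbitrary member of $\mathcal H$ otherwise), and put $$f_{t+1}=\mathrm{Round}\Big(\sum_{v\in[1/m]}\mathbf 1[f_t(x)=v]\,h_v^{t+1}(x)\Big),\qquad \mathrm{err}_t=\mathbb E_{(x,y)\sim\mathcal D}[(y-f_t(x))^2].$$ The output is $f_T$ for the first $T\ge 0$ with $\mathrm{err}_T-\mathrm{err}_{T+1}<\frac{\alpha}{2B}$. Theorem. There is a universal constant $C>0$ such that the following holds. Let $\mathcal H$ be as above with finite pseudodimension $d$, let $A_{\mathcal H}$ be a squared error regression oracle for $\mathcal H$, let $f:\mathcal X\to\mathbb R$ be measurable, and let $\epsilon,\delta,\alpha,B>0$, where $\delta\le\frac12$, or else $\alpha\le 2B$ and $2\alpha\le dB$. Let $\mathcal H_{\mathrm{boost}}$ be the class of all models that LSBoost$(f,\alpha,A_{\mathcal H},\mathcal D',B)$ can output, for any probability distribution $\mathcal D'$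 on $\mathcal Z$. Let $\mathcal D$ be a probability distribution on $\mathcal Z$, and let $D=\{(x_1,y_1),\dots,(x_n,y_n)\}$ be drawn i.i.d. from $\mathcal D$, where $$n\;\ge\; C\left(\frac{dB^3\log^2(dB/\alpha)}{\alpha^3\epsilon^2}+\frac{\log(1/\delta)}{\epsilon^2}\right)$$ (the first term is $0$ if $d=0$). Then $$\Pr\left[\sup_{h\in\mathcal H_{\mathrm{boost}}}\left|\mathop{\mathbb E}_{(x,y)\sim\mathcal D}[(y-h(x))^2]-\frac1n\sum_{i=1}^n(y_i-h(x_i))^2\right|\ge\epsilon\right]\le\delta .$$ -/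

import Mathlib

open MeasureTheory

noncomputable section

namespace LSBoost

universe u

/-- Labelled examples: a feature in `X` together with a label in `[0, 1]`. -/
abbrev Example (X : Type u) : Type u := X × unitInterval

/-- The points `x 1, …, x m`, with the real targets `y 1, …, y m`, are pseudo-shattered by `H`:
every pattern `b` is realised by some `h ∈ H`, in the sense `h (x i) > y i ↔ b i = 1`. -/
def PseudoShatters {X : Type u} (H : Set (X → ℝ)) {m : ℕ} (x : Fin m → X) (y : Fin m → ℝ) :
    Prop :=
  ∀ b : Fin m → Bool, ∃ h ∈ H, ∀ i, h (x i) > y i ↔ b i = true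

/-- `d` is the pseudodimension of `H`: the largest number of points that `H` pseudo-shatters.
(Pseudo-shattered points are automatically distinct.) -/
def HasPseudodimension {X : Type u} (H : Set (X → ℝ)) (d : ℕ) : Prop :=
  IsGreatest {m : ℕ | ∃ (x : Fin m → X) (y : Fin m → ℝ), PseudoShatters H x y} d

/-- The measurability assumption on a function class (a permissible class): the class
is indexed by a standard Borel space in such a way that evaluation is jointly measurable. -/
def IsPermissible {X : Type u} [MeasurableSpace X] (H : Set (X → ℝ)) : Prop :=
  ∃ (Θ : Type) (_ : MeasurableSpace Θ) (_ : StandardBorelSpace Θ) (g : Θ → X → ℝ),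
    Measurable (fun p : Θ × X => g p.1 p.2) ∧ H = Set.range g

/-- `A` is a squared error regression oracle for `H`: on every distribution `D` over labelled
examples, `A D` minimises the expected squared error over `H`. The expectation is taken in
`[0, ∞]`, because functions in `H` may be unbounded. -/
def IsRegressionOracle {X : Type u} [MeasurableSpace X] (H : Set (X → ℝ))
    (A : Measure (Example X) → X → ℝ) : Prop :=
  ∀ D : Measure (Example X), IsProbabilityMeasure D →
    A D ∈ H ∧ ∀ h ∈ H,
      ∫⁻ z, ENNReal.ofReal ((A D z.1 - (z.2 : ℝ)) ^ 2) ∂D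
        ≤ ∫⁻ z, ENNReal.ofReal ((h z.1 - (z.2 : ℝ)) ^ 2) ∂D

/-- The point of the grid `{0, 1/m, …, 1}` nearest to `r`; ties are rounded up. -/
def roundGrid (m : ℕ) (r : ℝ) : ℝ :=
  ((max 0 (min (m : ℤ) (round ((m : ℝ) * r))) : ℤ) : ℝ) / m

/-- `roundGrid m r` is a point of the grid. -/
theorem roundGrid_mem (m : ℕ) (r : ℝ) : ∃ k ≤ m, roundGrid m r = (k : ℝ) / m := by
  obtain ⟨k, hk⟩ : ∃ k : ℕ, max 0 (min (m : ℤ) (round ((m : ℝ) * r))) = (k : ℤ) :=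
    ⟨_, (Int.toNat_of_nonneg (le_max_left _ _)).symm⟩
  refine ⟨k, by omega, ?_⟩
  unfold roundGrid
  rw [hk]
  simp

/-- `roundGrid m r` is at least as close to `r` as every grid point. -/
theorem abs_sub_roundGrid_le {m : ℕ} (hm : 0 < m) (r : ℝ) {k : ℕ} (hk : k ≤ m) :
    |r - roundGrid m r| ≤ |r - (k : ℝ) / m| := by
  have hm' : (0 : ℝ) < m := by exact_mod_cast hm
  have key : |(m : ℝ) * r - ((max 0 (min (m : ℤ) (round ((m : ℝ) * r))) : ℤ) : ℝ)|
      ≤ |(m : ℝ) * r - (k : ℝ)| := by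
    have hk' : (k : ℝ) ≤ m := by exact_mod_cast hk
    have hk0 : (0 : ℝ) ≤ k := Nat.cast_nonneg k
    have hb := abs_le.1 (abs_sub_round ((m : ℝ) * r))
    rcases le_total (round ((m : ℝ) * r)) 0 with h0 | h0
    · have e : max 0 (min (m : ℤ) (round ((m : ℝ) * r))) = 0 := by omega
      rw [e]
      rcases eq_or_lt_of_le h0 with h1 | h1
      · rcases Nat.eq_zero_or_pos k with h2 | h2
        · simp [h2]
        · rw [h1] at hb
          have h3 : (1 : ℝ) ≤ k := by exact_mod_cast h2
          push_cast at hb ⊢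
          rw [abs_of_nonpos (a := (m : ℝ) * r - k) (by linarith)]
          exact abs_le.2 ⟨by linarith, by linarith⟩
      · have h3 : ((round ((m : ℝ) * r) : ℤ) : ℝ) ≤ -1 := by
          exact_mod_cast (by omega : round ((m : ℝ) * r) ≤ -1)
        push_cast
        rw [abs_of_nonpos (by linarith), abs_of_nonpos (by linarith)]
        linarith
    · rcases le_total (round ((m : ℝ) * r)) (m : ℤ) with h4 | h4
      · have e : max 0 (min (m : ℤ) (round ((m : ℝ) * r))) = round ((m : ℝ) * r) := by omega
        rw [e]
        exact_mod_cast round_le ((m : ℝ) * r) (k : ℤ)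
      · have e : max 0 (min (m : ℤ) (round ((m : ℝ) * r))) = (m : ℤ) := by omega
        rw [e]
        have h5 : (m : ℝ) ≤ ((round ((m : ℝ) * r) : ℤ) : ℝ) := by exact_mod_cast h4
        push_cast
        rcases eq_or_lt_of_le hk with h6 | h6
        · rw [h6]
        · have h7 : (k : ℝ) + 1 ≤ m := by exact_mod_cast h6
          rw [abs_of_nonneg (a := (m : ℝ) * r - k) (by linarith)]
          exact abs_le.2 ⟨by linarith, by linarith⟩
  have conv : ∀ c : ℝ, |r - c / m| = |(m : ℝ) * r - c| / m := by
    intro c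
    rw [← abs_of_pos hm', ← abs_div, abs_of_pos hm']
    congr 1
    field_simp
  unfold roundGrid
  rw [conv, conv]
  gcongr

/-- The expected squared error of the model `f` on the distribution `D`. -/
def sqError {X : Type u} [MeasurableSpace X] (D : Measure (Example X)) (f : X → ℝ) : ℝ :=
  ∫ z, ((z.2 : ℝ) - f z.1) ^ 2 ∂D

/-- The average squared error of the model `f` on a sample of `n` labelled examples. -/
def empiricalSqError {X : Type u} {n : ℕ} (S : Fin n → Example X) (f : X → ℝ) : ℝ :=
  (∑ i, (((S i).2 : ℝ) - f (S i).1) ^ 2) / n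

/-- One round of the algorithm, from the model `f` to the model `f'`. The `k`-th level set is
`{x | f x = k / m}` for `0 ≤ k ≤ m`. If it has positive probability, the oracle is called on `D`
conditioned on it; if it has probability zero, the conditional distribution does not exist and
the round may use any member of `H` there. -/
def IsRound {X : Type u} [MeasurableSpace X] (H : Set (X → ℝ))
    (A : Measure (Example X) → X → ℝ) (D : Measure (Example X)) (m : ℕ) (f f' : X → ℝ) : Prop :=
  ∃ h : ℕ → X → ℝ,
    (∀ k ≤ m, h k ∈ H) ∧
    (∀ k ≤ m, D {z | f z.1 = (k : ℝ) / m} ≠ 0 →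
      h k = A (ProbabilityTheory.cond D {z | f z.1 = (k : ℝ) / m})) ∧
    ∀ x, f' x = roundGrid m
      (∑ k ∈ Finset.range (m + 1), Set.indicator {x' | f x' = (k : ℝ) / m} (h k) x)

/-- `g` is an output of LSBoost with initial model `f`, parameters `α` and `B`, oracle `A` for `H`
and input distribution `D`. The grid has `m = ⌈2B/α⌉` steps. The models are `F 0, F 1, …`;
the loop is always entered at `F 0`, it continues as long as the last round decreased the error by
at least `α / (2B)`, and when the round from `F T` to `F (T + 1)` fails to do so,
the output is `F T`. -/
def IsOutput {X : Type u} [MeasurableSpace X] (H : Set (X → ℝ))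
    (A : Measure (Example X) → X → ℝ) (f : X → ℝ) (α B : ℝ) (D : Measure (Example X))
    (g : X → ℝ) : Prop :=
  ∃ (F : ℕ → X → ℝ) (T : ℕ),
    (∀ x, F 0 x = roundGrid ⌈2 * B / α⌉₊ (f x)) ∧
    (∀ t ≤ T, IsRound H A D ⌈2 * B / α⌉₊ (F t) (F (t + 1))) ∧
    (∀ t < T, α / (2 * B) ≤ sqError D (F t) - sqError D (F (t + 1))) ∧
    sqError D (F T) - sqError D (F (T + 1)) < α / (2 * B) ∧
    g = F T

/-- The class of all models that LSBoost can output, over all input distributions. -/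
def boostClass {X : Type u} [MeasurableSpace X] (H : Set (X → ℝ))
    (A : Measure (Example X) → X → ℝ) (f : X → ℝ) (α B : ℝ) : Set (X → ℝ) :=
  {g | ∃ D : Measure (Example X), IsProbabilityMeasure D ∧ IsOutput H A f α B D g}

end LSBoost

end

/-! Every round before the output lowers an error lying in `[0, 1]` by at least `α / (2B)`, so an
output arises after at most `2B/α ≤ m` rounds (`exists_eq_boostIter_of_mem_boostClass`). The output
class therefore sits inside the class of all iterates of at most `m` rounds with arbitrary members
of `H` on the level sets, and uniform convergence is proved for that larger class.

Its growth is polynomial. A rounded member of `H` is determined on `k` points by which of `m * k`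
thresholds it reaches, so Sauer-Shelah leaves at most `(m * k + 1) ^ d` patterns
(`encard_range_roundGrid_le`). A round combines the previous pattern with `m + 1` of these. In total
there are at most `(m * k + 1) ^ V` patterns, with `V = d * (m + 1) * m + 1`
(`encard_range_boostIter_le`).

For `[0, 1]`-valued classes of growth `(a * k + 1) ^ V`,
`measure_exists_lt_abs_integral_sub_mean_le` needs only `n * ε ^ 2` of order `V * log (4 * a * V) +
log (1 / δ)`. A union bound over all patterns on the sample would cost an extra `log n`. Chaining
avoids it, because the packing numbers at mean distance `r` are bounded independently of `n`: a few
random points already separate a packing (`card_le_of_separated`, `log_le_of_forall_le_pow`). With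
`b = B/α`, `V * log (4 * m * V)` is of order `d * b ^ 2 * log (d * b)` when `d * b ≥ 2`, which the
stated sample size dominates.

Bad events are unions over an uncountable parameter set and may fail to be measurable. They are
projections along a standard Borel space, hence inner regular for the outer measure
(`exists_measurableSet_subset_snd_image`), which suffices for symmetrization. -/

noncomputable section

namespace LSBoost

/-! ### Inner regularity of projections of measurable sets -/

section Projection

open Set Filter Topology

/-- Analytic subsets of a metrizable space are inner regular, for their outer measure, with respect
to compact sets. -/
theorem exists_isCompact_le_of_analyticSet {α : Type*} [TopologicalSpace α]
    [PolishSpace α] [MeasurableSpace α] [BorelSpace α] (μ : Measure α) [IsFiniteMeasure μ]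
    {s : Set α} (hs : AnalyticSet s) {η : ENNReal} (hη : η < μ s) :
    ∃ K ⊆ s, IsCompact K ∧ η ≤ μ K := by
  rw [AnalyticSet] at hs
  rcases hs with rfl | ⟨F, hF, rfl⟩
  · simp at hη
  -- Outer measure is continuous along increasing unions of arbitrary sets, so one coordinate can be
  -- bounded while the image keeps outer measure above `η`. Iterating over the coordinates cuts
  -- Baire space down to the compact box `C`.
  have step : ∀ (S : Set (ℕ → ℕ)) (k : ℕ), ∃ N : ℕ, η < μ (F '' S) →
      η < μ (F '' (S ∩ {x | x k ≤ N})) := by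
    intro S k
    by_cases h : η < μ (F '' S)
    · have e : F '' S = ⋃ N : ℕ, F '' (S ∩ {x | x k ≤ N}) := by
        rw [← image_iUnion, ← inter_iUnion]
        congr 1
        refine (inter_eq_left.2 fun x _ => ?_).symm
        exact mem_iUnion.2 ⟨x k, le_refl (x k)⟩
      have mono : Monotone fun N : ℕ => F '' (S ∩ {x | x k ≤ N}) := by
        intro a b hab
        exact image_mono (inter_subset_inter_right _ fun x (hx : x k ≤ a) => hx.trans hab)
      rw [e, mono.measure_iUnion] at h
      obtain ⟨N, hN⟩ := lt_iSup_iff.1 h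
      exact ⟨N, fun _ => hN⟩
    · exact ⟨0, fun h' => absurd h' h⟩
  choose N hN using step
  let S : ℕ → Set (ℕ → ℕ) := fun k => Nat.rec univ (fun k T => T ∩ {x | x k ≤ N T k}) k
  let n : ℕ → ℕ := fun k => N (S k) k
  have hS : ∀ k, S k = {x | ∀ i < k, x i ≤ n i} := by
    intro k
    induction k with
    | zero => simp [S]
    | succ k ih =>
      change S k ∩ {x | x k ≤ n k} = _
      rw [ih]
      ext x
      simp only [mem_inter_iff, mem_ofPred_eq, Nat.forall_lt_succ_right]
  have hμS : ∀ k, η < μ (F '' S k) := by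
    intro k
    induction k with
    | zero => simpa [S] using hη
    | succ k ih => exact hN (S k) k ih
  let C : Set (ℕ → ℕ) := univ.pi fun i => Iic (n i)
  have hC : IsCompact C := isCompact_univ_pi fun i => (finite_Iic (n i)).isCompact
  have hK : IsCompact (F '' C) := hC.image hF
  refine ⟨F '' C, image_subset_range _ _, hK, ?_⟩
  -- `S k` constrains only the coordinates below `k`. If no `S k` were mapped into the neighbourhood
  -- `U` of `F '' C`, points witnessing this could be truncated into `C`; truncation leaves the
  -- first `k` coordinates alone, so a limit of the truncations is also a limit of the points,
  -- contradicting that `F ⁻¹' U` is open.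
  have hsub : ⋂ k, closure (F '' S k) ⊆ F '' C := by
    intro y hy
    by_contra hyK
    obtain ⟨U, V, hU, hV, hKU, hyV, hUV⟩ := hK.separation_of_notMem hyK
    have : ∃ k, S k ⊆ F ⁻¹' U := by
      by_contra! hcon
      simp only [not_subset] at hcon
      choose x hxS hxU using hcon
      have hx' : ∀ k, (fun i => min (x k i) (n i)) ∈ C := fun k i _ => mem_Iic.2 (min_le_right _ _)
      obtain ⟨z, hz, φ, hφ, hlim⟩ := hC.tendsto_subseq hx'
      have hlim' : Tendsto (x ∘ φ) atTop (𝓝 z) := by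
        rw [tendsto_pi_nhds] at hlim ⊢
        intro i
        refine (hlim i).congr' ?_
        filter_upwards [eventually_gt_atTop i] with k hk
        have h1 : i < φ k := hk.trans_le (hφ.id_le k)
        have h2 := hxS (φ k)
        rw [hS] at h2
        exact min_eq_left (h2 i h1)
      have hzU : F z ∈ U := hKU (mem_image_of_mem F hz)
      obtain ⟨k, hk⟩ := (hlim'.eventually ((hU.preimage hF).mem_nhds hzU)).exists
      exact hxU _ hk
    obtain ⟨k, hk⟩ := this
    obtain ⟨w, hwV, hwS⟩ := mem_closure_iff.1 (mem_iInter.1 hy k) V hV hyV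
    exact disjoint_left.1 hUV (image_subset_iff.2 hk hwS) hwV
  have anti : Antitone fun k => closure (F '' S k) := by
    refine antitone_nat_of_succ_le fun k => closure_mono (image_mono ?_)
    exact inter_subset_left
  -- Continuity from above requires measurability, which the closures have and the images `F '' S k`
  -- need not.
  have hlim := tendsto_measure_iInter_atTop (μ := μ)
    (fun k => (isClosed_closure (s := F '' S k)).measurableSet.nullMeasurableSet) anti
    ⟨0, measure_ne_top _ _⟩
  exact (ge_of_tendsto' hlim fun k => (hμS k).le.trans (measure_mono subset_closure)).trans
    (measure_mono hsub)

/-- A measurable subset of a product depends on the second variable only through countably many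
measurable sets. -/
theorem exists_preimage_prodMap_eq {Θ Ω : Type*} [MeasurableSpace Θ] [MeasurableSpace Ω]
    {B : Set (Θ × Ω)} (hB : MeasurableSet B) :
    ∃ (φ : Ω → ℕ → Bool) (B' : Set (Θ × (ℕ → Bool))), Measurable φ ∧ MeasurableSet B' ∧
      B = Prod.map id φ ⁻¹' B' := by
  classical
  rw [← generateFrom_prod] at hB
  induction B, hB using MeasurableSpace.generateFrom_induction with
  | hC B hB _ =>
    obtain ⟨s, hs, t, ht, rfl⟩ := hB
    refine ⟨fun ω _ => decide (ω ∈ t), s ×ˢ {x | x 0 = true}, ?_, ?_, ?_⟩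
    · exact measurable_pi_lambda _ fun _ => measurable_to_bool (by
        convert (show MeasurableSet t from ht) using 1
        ext; simp)
    · exact MeasurableSet.prod hs (measurableSet_eq_fun (measurable_pi_apply 0) measurable_const)
    · ext; simp
  | empty => exact ⟨fun _ _ => true, ∅, measurable_const, MeasurableSet.empty, rfl⟩
  | compl B _ ih =>
    obtain ⟨φ, B', hφ, hB', rfl⟩ := ih
    exact ⟨φ, B'ᶜ, hφ, hB'.compl, rfl⟩
  | iUnion B _ ih =>
    choose φ B' hφ hB' e using ih
    -- Countably many Boolean codes are merged into one through the pairing of `ℕ × ℕ` with `ℕ`.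
    refine ⟨fun ω n => φ n.unpair.1 ω n.unpair.2,
      ⋃ i, Prod.map id (fun x j => x (Nat.pair i j)) ⁻¹' B' i, ?_, ?_, ?_⟩
    · exact measurable_pi_lambda _ fun n => (measurable_pi_apply _).comp (hφ _)
    · exact MeasurableSet.iUnion fun i => (measurable_id.prodMap
        (measurable_pi_lambda _ fun j => measurable_pi_apply _)) (hB' i)
    · rw [preimage_iUnion]
      refine iUnion_congr fun i => ?_
      rw [e i, ← preimage_comp]
      congr 1
      ext ⟨θ, ω⟩ <;> simp

/-- The projection of a measurable set along a standard Borel space is inner regular, for its outer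
measure, with respect to measurable sets. -/
theorem exists_measurableSet_subset_snd_image {Θ Ω : Type*} [MeasurableSpace Θ]
    [StandardBorelSpace Θ] [MeasurableSpace Ω] (μ : Measure Ω) [IsFiniteMeasure μ]
    {B : Set (Θ × Ω)} (hB : MeasurableSet B) {η : ENNReal} (hη : η < μ (Prod.snd '' B)) :
    ∃ A ⊆ Prod.snd '' B, MeasurableSet A ∧ η ≤ μ A := by
  obtain ⟨φ, B', hφ, hB', rfl⟩ := exists_preimage_prodMap_eq hB
  have himg : Prod.snd '' (Prod.map id φ ⁻¹' B') = φ ⁻¹' (Prod.snd '' B') := by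
    ext ω
    simp
  rw [himg] at hη ⊢
  have : PolishSpace Bool := { }
  have han : AnalyticSet (Prod.snd '' B') := hB'.analyticSet_image measurable_snd
  obtain ⟨K, hK, hKc, hle⟩ := exists_isCompact_le_of_analyticSet (μ.map φ) han
    (hη.trans_le (Measure.le_map_apply hφ.aemeasurable _))
  refine ⟨φ ⁻¹' K, preimage_mono hK, hφ hKc.measurableSet, ?_⟩
  rwa [Measure.map_apply hφ hKc.measurableSet] at hle

end Projection

/-! ### Tail bounds for random signs -/

open Finset in
/-- Hoeffding's inequality for a sum of independent random signs, one tail, as a counting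
statement. -/
theorem card_signs_le_sum {ι : Type*} [Fintype ι] [DecidableEq ι] (u : ι → ℝ) {v t : ℝ}
    (hv : 0 < v) (hu : ∑ i, u i ^ 2 ≤ v) (ht : 0 ≤ t) :
    (#{σ : ι → Bool | t ≤ ∑ i, bif σ i then - u i else u i} : ℝ)
      ≤ 2 ^ Fintype.card ι * Real.exp (- t ^ 2 / (2 * v)) := by
  -- The Chernoff parameter: it minimises `l ^ 2 * v / 2 - l * t`.
  set l := t / v
  have hl : 0 ≤ l := div_nonneg ht hv.le
  have h1 : ∑ σ : ι → Bool, Real.exp (l * ∑ i, bif σ i then - u i else u i)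
      ≤ 2 ^ Fintype.card ι * Real.exp (l ^ 2 * v / 2) := by
    have e : ∀ σ : ι → Bool, Real.exp (l * ∑ i, bif σ i then - u i else u i)
        = ∏ i, bif σ i then Real.exp (-(l * u i)) else Real.exp (l * u i) := by
      intro σ
      rw [mul_sum, Real.exp_sum]
      refine prod_congr rfl fun i _ => ?_
      cases σ i <;> simp
    simp_rw [e]
    have e2 := Finset.prod_univ_sum (fun _ : ι => (univ : Finset Bool))
      (fun i b => bif b then Real.exp (-(l * u i)) else Real.exp (l * u i))
    rw [Fintype.piFinset_univ] at e2
    rw [← e2]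
    have e3 : ∀ i, ∑ b : Bool, (bif b then Real.exp (-(l * u i)) else Real.exp (l * u i))
        = 2 * Real.cosh (l * u i) := by
      intro i
      rw [Real.cosh_eq, Fintype.sum_bool]
      simp only [cond_true, cond_false]
      ring
    simp_rw [e3]
    rw [prod_mul_distrib, prod_const, card_univ]
    gcongr
    calc ∏ i, Real.cosh (l * u i) ≤ ∏ i, Real.exp ((l * u i) ^ 2 / 2) :=
          prod_le_prod (fun i _ => (Real.cosh_pos _).le) fun i _ => Real.cosh_le_exp_half_sq _
      _ = Real.exp (l ^ 2 * (∑ i, u i ^ 2) / 2) := by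
          rw [← Real.exp_sum, mul_sum, sum_div]
          congr 1
          refine sum_congr rfl fun i _ => by ring
      _ ≤ _ := by gcongr
  have h2 : (#{σ : ι → Bool | t ≤ ∑ i, bif σ i then - u i else u i} : ℝ) * Real.exp (l * t)
      ≤ ∑ σ : ι → Bool, Real.exp (l * ∑ i, bif σ i then - u i else u i) := by
    rw [← nsmul_eq_mul, ← sum_const]
    refine (sum_le_sum fun σ hσ => ?_).trans
      (sum_le_sum_of_subset_of_nonneg (filter_subset _ _) fun σ _ _ => (Real.exp_pos _).le)
    rw [mem_filter] at hσ
    have := hσ.2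
    gcongr
  have h3 := h2.trans h1
  rw [← le_div_iff₀ (Real.exp_pos _), mul_div_assoc, ← Real.exp_sub] at h3
  have e : l ^ 2 * v / 2 - l * t = - t ^ 2 / (2 * v) := by
    rw [show l = t / v from rfl]
    field_simp
    ring
  rwa [e] at h3

open Finset in
/-- Hoeffding's inequality for a sum of independent random signs, as a counting statement. -/
theorem card_signs_le_abs_sum {ι : Type*} [Fintype ι] [DecidableEq ι] (u : ι → ℝ) {v t : ℝ}
    (hv : 0 < v) (hu : ∑ i, u i ^ 2 ≤ v) (ht : 0 ≤ t) :
    (#{σ : ι → Bool | t ≤ |∑ i, bif σ i then - u i else u i|} : ℝ)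
      ≤ 2 ^ Fintype.card ι * (2 * Real.exp (- t ^ 2 / (2 * v))) := by
  have h1 := card_signs_le_sum u hv hu ht
  have h2 := card_signs_le_sum (fun i => - u i) hv (by simpa using hu) ht
  have h3 : (univ.filter fun σ : ι → Bool => t ≤ |∑ i, bif σ i then - u i else u i|)
      ⊆ (univ.filter fun σ : ι → Bool => t ≤ ∑ i, bif σ i then - u i else u i)
        ∪ (univ.filter fun σ : ι → Bool => t ≤ ∑ i, bif σ i then - - u i else - u i) := by
    intro σ hσ
    simp only [mem_filter, mem_univ, true_and, mem_union] at hσ ⊢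
    have e : ∑ i, (bif σ i then - - u i else - u i) = - ∑ i, bif σ i then - u i else u i := by
      rw [← sum_neg_distrib]
      refine sum_congr rfl fun i _ => ?_
      cases σ i <;> simp
    rw [e]
    exact le_abs.1 hσ
  have h4 : (#{σ : ι → Bool | t ≤ |∑ i, bif σ i then - u i else u i|} : ℝ) ≤ _ :=
    Nat.cast_le.2 ((card_le_card h3).trans (card_union_le _ _))
  push_cast at h4
  linarith

/-! ### Packing numbers of classes of polynomial growth -/

open Finset in
/-- If functions with values in `[0, 1]` are pairwise `r`-separated in mean distance, then some
`k` points tell them apart, as soon as `k` is large enough for random points to do so. -/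
theorem card_le_of_separated {I : Type*} [Fintype I] [Nonempty I] (T : Finset (I → ℝ))
    (hT : ∀ p ∈ T, ∀ i, p i ∈ Set.Icc (0 : ℝ) 1) {r : ℝ}
    (hsep : ∀ p ∈ T, ∀ q ∈ T, p ≠ q → r * Fintype.card I < ∑ i, |p i - q i|)
    {k P : ℕ} (hP : ∀ s : Fin k → I, (Set.range fun (p : T) j => p.1 (s j)).encard ≤ P)
    (hk : (#T : ℝ) ^ 2 * Real.exp (- r * k) < 1) : #T ≤ P := by
  classical
  have hI : (0 : ℝ) < Fintype.card I := by exact_mod_cast Fintype.card_pos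
  -- The samples that do not distinguish `p` from `q`. Since `|p i - q i| ≤ 1`, separation forces
  -- disagreement on more than a fraction `r` of the points, so a sample is bad with probability at
  -- most `exp (-r * k)`; a union bound over pairs leaves a good sample.
  let bad : (I → ℝ) × (I → ℝ) → Finset (Fin k → I) := fun pq =>
    Fintype.piFinset fun _ => {i | pq.1 i = pq.2 i}
  have hbad : ∀ pq ∈ T.offDiag,
      (#(bad pq) : ℝ) ≤ (Fintype.card I : ℝ) ^ k * Real.exp (- r * k) := by
    rintro ⟨p, q⟩ hpq
    rw [mem_offDiag] at hpq
    obtain ⟨hp, hq, hne⟩ := hpq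
    have h1 : ∑ i, |p i - q i| ≤ #{i | ¬ p i = q i} := by
      rw [card_filter]
      push_cast
      refine sum_le_sum fun i _ => ?_
      have hpi := hT p hp i
      have hqi := hT q hq i
      by_cases h : p i = q i
      · simp [h]
      · rw [if_pos h]
        exact abs_le.2 ⟨by linarith [hpi.1, hqi.2], by linarith [hpi.2, hqi.1]⟩
    have h2 : (#{i | p i = q i} : ℝ) + #{i | ¬ p i = q i} = Fintype.card I := by
      have := card_filter_add_card_filter_not (s := (univ : Finset I)) (fun i => p i = q i)
      rw [card_univ] at this
      exact_mod_cast this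
    have h3 := hsep p hp q hq hne
    have h4 : (#{i | p i = q i} : ℝ) ≤ Fintype.card I * Real.exp (-r) := by
      have := Real.add_one_le_exp (-r)
      nlinarith
    simp only [bad, Fintype.card_piFinset, prod_const, card_univ, Fintype.card_fin, Nat.cast_pow]
    calc (#{i | p i = q i} : ℝ) ^ k ≤ (Fintype.card I * Real.exp (-r)) ^ k := by gcongr
      _ = _ := by rw [mul_pow, ← Real.exp_nat_mul]; ring_nf
  have hex : ∃ s : Fin k → I, s ∉ T.offDiag.biUnion bad := by
    by_contra! hcon
    have h1 : (Fintype.card I) ^ k ≤ ∑ pq ∈ T.offDiag, #(bad pq) := by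
      have h2 : (univ : Finset (Fin k → I)) ⊆ T.offDiag.biUnion bad := fun s _ => hcon s
      have h3 := (card_le_card h2).trans card_biUnion_le
      simpa using h3
    have h2 : ((Fintype.card I : ℝ)) ^ k ≤ ∑ pq ∈ T.offDiag, (#(bad pq) : ℝ) := by
      exact_mod_cast h1
    have h3 := h2.trans (sum_le_sum hbad)
    rw [sum_const, nsmul_eq_mul] at h3
    have h4 : (#T.offDiag : ℝ) ≤ (#T : ℝ) ^ 2 := by
      have : #T.offDiag ≤ #T ^ 2 := by rw [offDiag_card, sq]; exact Nat.sub_le _ _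
      exact_mod_cast this
    have hIk : (0 : ℝ) < (Fintype.card I : ℝ) ^ k := by positivity
    have h5 : (#T.offDiag : ℝ) * ((Fintype.card I : ℝ) ^ k * Real.exp (- r * k))
        ≤ (Fintype.card I : ℝ) ^ k * ((#T : ℝ) ^ 2 * Real.exp (- r * k)) := by
      rw [mul_left_comm]
      gcongr
    nlinarith
  obtain ⟨s, hs⟩ := hex
  have hinj : Function.Injective fun (p : T) (j : Fin k) => p.1 (s j) := by
    rintro ⟨p, hp⟩ ⟨q, hq⟩ h
    by_contra hne
    refine hs (mem_biUnion.2 ⟨(p, q), mem_offDiag.2 ⟨hp, hq, fun h => hne (Subtype.ext h)⟩, ?_⟩)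
    simp only [bad, Fintype.mem_piFinset, mem_filter, mem_univ, true_and]
    exact fun j => congrFun h j
  have := hP s
  rw [← Set.image_univ, hinj.injOn.encard_image, Set.encard_univ] at this
  simpa using this

/-- Solving the self-referential bound of `card_le_of_separated` for the cardinality. -/
theorem log_le_of_forall_le_pow {N a V : ℕ} (ha : 1 ≤ a) (hV : 1 ≤ V) {r : ℝ} (hr : 0 < r)
    (hr1 : r ≤ 1)
    (h : ∀ k : ℕ, 1 ≤ k → (N : ℝ) ^ 2 * Real.exp (- r * k) < 1 → N ≤ (a * k + 1) ^ V) :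
    Real.log N ≤ 2 * V * Real.log (4 * a * V / r) := by
  have ha' : (1 : ℝ) ≤ a := by exact_mod_cast ha
  have hV' : (1 : ℝ) ≤ V := by exact_mod_cast hV
  have hs : 1 ≤ 4 * a * V / r := by
    rw [le_div_iff₀ hr]
    nlinarith
  rcases Nat.eq_zero_or_pos N with rfl | hN
  · have := Real.log_nonneg hs
    simp only [Nat.cast_zero, Real.log_zero]
    positivity
  have hN' : (1 : ℝ) ≤ N := by exact_mod_cast hN
  set x := Real.log N with hx
  have hx0 : 0 ≤ x := Real.log_nonneg hN'
  -- Large enough that `r * k > 2 * x`, which is the requirement `N ^ 2 * exp (-r * k) < 1`.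
  let k := ⌊2 * x / r⌋₊ + 1
  have hk1 : 2 * x / r < k := by
    simp only [k]
    push_cast
    exact Nat.lt_floor_add_one _
  have hk2 : (k : ℝ) ≤ 2 * x / r + 1 := by
    simp only [k]
    push_cast
    linarith [Nat.floor_le (show 0 ≤ 2 * x / r by positivity)]
  have hN2 : (N : ℝ) ≤ ((a * k + 1 : ℝ)) ^ V := by
    have := h k (Nat.le_add_left _ _) ?_
    · exact_mod_cast this
    · rw [← Real.exp_log (show (0 : ℝ) < N by linarith), ← hx, ← Real.exp_nat_mul,
        ← Real.exp_add, Real.exp_lt_one_iff]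
      rw [div_lt_iff₀ hr] at hk1
      push_cast
      linarith
  have hk0 : (0 : ℝ) ≤ k := Nat.cast_nonneg k
  have h1 : x ≤ V * Real.log (a * k + 1) := by
    have := Real.log_le_log (by linarith) hN2
    rwa [Real.log_pow] at this
  set s := 4 * a * V / r with hsdef
  have hs0 : 0 < s := by linarith
  -- The tangent to `log` at `s`. This `s` makes the slope so small that, after multiplication by
  -- `V`, the linear term returns at most `x / 2 + r / 2`; half of `x` is absorbed on the left and
  -- `r ≤ 1 ≤ V` handles the rest.
  have h2 : Real.log (a * k + 1) ≤ (a * k + 1) / s - 1 + Real.log s := by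
    have := Real.log_le_sub_one_of_pos (show 0 < (a * k + 1 : ℝ) / s by positivity)
    rw [Real.log_div (by positivity) hs0.ne'] at this
    linarith
  have h3 : V * ((a * k + 1) / s) ≤ x / 2 + r / 2 := by
    have e : x / 2 + r / 2 = V * ((2 * a * x / r + 2 * a) / s) := by
      rw [hsdef]
      field_simp
      ring
    rw [e]
    have h4 : a * k ≤ a * (2 * x / r + 1) := by gcongr
    have e2 : a * (2 * x / r + 1) = 2 * a * x / r + a := by ring
    have h5 : (a * k + 1 : ℝ) ≤ 2 * a * x / r + 2 * a := by linarith
    exact mul_le_mul_of_nonneg_left (div_le_div_of_nonneg_right h5 hs0.le) (by linarith)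
  nlinarith [mul_le_mul_of_nonneg_left h2 (show (0 : ℝ) ≤ V by linarith)]

open Finset in
/-- A maximal separated subset is a net. -/
theorem exists_separated_net {I : Type*} [Fintype I] (W : Finset (I → ℝ)) {c : ℝ} (hc : 0 ≤ c) :
    ∃ U ⊆ W, (∀ p ∈ U, ∀ q ∈ U, p ≠ q → c < ∑ i, |p i - q i|) ∧
      ∀ p ∈ W, ∃ q ∈ U, ∑ i, |p i - q i| ≤ c := by
  classical
  obtain ⟨U, hU, hmax⟩ := exists_max_image
    (W.powerset.filter fun U => ∀ p ∈ U, ∀ q ∈ U, p ≠ q → c < ∑ i, |p i - q i|) card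
    ⟨∅, by simp⟩
  rw [mem_filter, mem_powerset] at hU
  refine ⟨U, hU.1, hU.2, fun p hp => ?_⟩
  by_contra! hcon
  have hpU : p ∉ U := fun h => by
    have := hcon p h
    simp at this
    linarith
  have := hmax (insert p U) ?_
  · rw [card_insert_of_notMem hpU] at this
    omega
  · rw [mem_filter, mem_powerset]
    refine ⟨insert_subset hp hU.1, ?_⟩
    intro x hx y hy hxy
    rw [mem_insert] at hx hy
    rcases hx with rfl | hx <;> rcases hy with rfl | hy
    · exact absurd rfl hxy
    · exact hcon y hy
    · simp_rw [abs_sub_comm (x _)]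
      exact hcon x hx
    · exact hU.2 x hx y hy hxy

/-! ### Chaining -/

open Finset in
/-- The union bound at one scale of the chaining argument. -/
theorem card_signs_exists_mem_le {ι β : Type*} [Fintype ι] [Nonempty ι] [DecidableEq ι]
    (U : Finset β) (u : β → ι → ℝ) {E ε δ : ℝ} (j : ℕ)
    (hu : ∀ q ∈ U, ∑ i, u q i ^ 2 ≤ 16 * Fintype.card ι * (1 / 4) ^ j)
    (hU : (#U : ℝ) ≤ Real.exp (E * (1 + j))) (hε : 0 ≤ ε) (hδ : 0 < δ) (hδ1 : δ ≤ 1)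
    (hn : 8192 * (E + Real.log (1 / δ) + 3) ≤ Fintype.card ι * ε ^ 2) :
    (#{σ : ι → Bool | ∃ q ∈ U, Fintype.card ι * (ε / 16 * (3 / 4) ^ j)
        ≤ |∑ i, bif σ i then - u q i else u q i|} : ℝ)
      ≤ 2 ^ Fintype.card ι * (2 * δ * (1 / 8) ^ (j + 1)) := by
  classical
  set n := (Fintype.card ι : ℝ) with hnn
  have hn0 : 0 < n := by
    rw [hnn]
    exact_mod_cast Fintype.card_pos
  have hsub : (univ.filter fun σ : ι → Bool => ∃ q ∈ U, n * (ε / 16 * (3 / 4) ^ j)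
        ≤ |∑ i, bif σ i then - u q i else u q i|)
      ⊆ U.biUnion fun q => univ.filter fun σ : ι → Bool => n * (ε / 16 * (3 / 4) ^ j)
        ≤ |∑ i, bif σ i then - u q i else u q i| := by
    intro σ hσ
    simpa using hσ
  have h1 : (#{σ : ι → Bool | ∃ q ∈ U, n * (ε / 16 * (3 / 4) ^ j)
        ≤ |∑ i, bif σ i then - u q i else u q i|} : ℝ)
      ≤ ∑ q ∈ U, (#{σ : ι → Bool | n * (ε / 16 * (3 / 4) ^ j)
        ≤ |∑ i, bif σ i then - u q i else u q i|} : ℝ) := by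
    exact_mod_cast (card_le_card hsub).trans card_biUnion_le
  have hlog : 0 ≤ Real.log (1 / δ) := Real.log_nonneg (by rw [le_div_iff₀ hδ]; linarith)
  -- The thresholds shrink like `(3/4) ^ j` while the variances shrink like `(1/4) ^ j`, so the
  -- Hoeffding exponent grows like `(9/4) ^ j ≥ 1 + j` and beats the entropy `E * (1 + j)`. The
  -- summand `3` leaves a factor `exp (-3 * (j + 1)) ≤ (1/8) ^ (j + 1)`, summable over the scales.
  have hexp : - (n * (ε / 16 * (3 / 4) ^ j)) ^ 2 / (2 * (16 * n * (1 / 4) ^ j))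
      ≤ - ((E + Real.log (1 / δ) + 3) * (1 + j)) := by
    have e : - (n * (ε / 16 * (3 / 4) ^ j)) ^ 2 / (2 * (16 * n * (1 / 4) ^ j))
        = - (n * ε ^ 2 / 8192 * (9 / 4) ^ j) := by
      have e1 : ((9 : ℝ) / 4) ^ j = ((3 / 4) ^ j) ^ 2 / (1 / 4) ^ j := by
        rw [← pow_mul, mul_comm j 2, pow_mul, ← div_pow]
        norm_num
      rw [e1]
      field_simp
      ring
    rw [e, neg_le_neg_iff]
    have h2 : 1 + (j : ℝ) ≤ (9 / 4) ^ j := by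
      have := one_add_mul_le_pow (show (-2 : ℝ) ≤ 5 / 4 by norm_num) j
      norm_num at this
      have hj : (0 : ℝ) ≤ j := Nat.cast_nonneg j
      linarith
    have h3 : E + Real.log (1 / δ) + 3 ≤ n * ε ^ 2 / 8192 := by linarith
    gcongr
  have h2 : ∀ q ∈ U, (#{σ : ι → Bool | n * (ε / 16 * (3 / 4) ^ j)
        ≤ |∑ i, bif σ i then - u q i else u q i|} : ℝ)
      ≤ 2 ^ Fintype.card ι * (2 * Real.exp (- ((E + Real.log (1 / δ) + 3) * (1 + j)))) := by
    intro q hq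
    refine (card_signs_le_abs_sum (u q) (by positivity) (hu q hq) (by positivity)).trans ?_
    gcongr
  refine (h1.trans (sum_le_sum h2)).trans ?_
  rw [sum_const, nsmul_eq_mul, mul_left_comm]
  refine mul_le_mul_of_nonneg_left ?_ (by positivity)
  rw [mul_left_comm, mul_assoc]
  refine mul_le_mul_of_nonneg_left ?_ zero_le_two
  have hj : (0 : ℝ) ≤ j := Nat.cast_nonneg j
  calc (#U : ℝ) * Real.exp (- ((E + Real.log (1 / δ) + 3) * (1 + j)))
      ≤ Real.exp (E * (1 + j)) * Real.exp (- ((E + Real.log (1 / δ) + 3) * (1 + j))) := by gcongr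
    _ = Real.exp (- (Real.log (1 / δ) * (1 + j))) * Real.exp (-3 * ((j + 1 : ℕ) : ℝ)) := by
      rw [← Real.exp_add, ← Real.exp_add]
      push_cast
      ring_nf
    _ ≤ δ * (1 / 8) ^ (j + 1) := by
      gcongr
      · rw [← Real.le_log_iff_exp_le hδ]
        rw [one_div, Real.log_inv] at *
        nlinarith
      · rw [mul_comm, Real.exp_nat_mul]
        gcongr
        rw [Real.exp_neg, one_div]
        gcongr
        have := Real.exp_one_gt_d9
        have e : Real.exp 3 = Real.exp 1 ^ 3 := by rw [← Real.exp_nat_mul]; norm_num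
        rw [e]
        calc (8 : ℝ) = 2 ^ 3 := by norm_num
          _ ≤ _ := by gcongr; linarith

open Finset in
/-- Chaining for the symmetrized process of a class of polynomial growth, conditionally on the
sample: `W` is the set of restrictions of the class to a double sample. -/
theorem card_signs_exists_le {ι : Type*} [Fintype ι] [Nonempty ι] [DecidableEq ι]
    (W : Finset (ι × Bool → ℝ)) (hW : ∀ p ∈ W, ∀ i, p i ∈ Set.Icc (0 : ℝ) 1) {a V : ℕ}
    (ha : 1 ≤ a) (hV : 1 ≤ V)
    (hgr : ∀ k : ℕ, 1 ≤ k → ∀ s : Fin k → ι × Bool,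
      (Set.range fun (p : W) j => p.1 (s j)).encard ≤ ((a * k + 1) ^ V : ℕ))
    {ε δ : ℝ} (hε : 0 ≤ ε) (hδ : 0 < δ) (hδ1 : δ ≤ 1)
    (hn : 8192 * (2 * (V * Real.log (4 * a * V)) + Real.log (1 / δ) + 3)
      ≤ Fintype.card ι * ε ^ 2) :
    (#{σ : ι → Bool | ∃ p ∈ W, Fintype.card ι * (ε / 4)
        ≤ |∑ i, bif σ i then - (p (i, false) - p (i, true)) else p (i, false) - p (i, true)|} : ℝ)
      ≤ 2 ^ Fintype.card ι * (δ / 2) := by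
  classical
  set n := (Fintype.card ι : ℝ) with hnn
  have hn0 : 0 < n := by
    rw [hnn]
    exact_mod_cast Fintype.card_pos
  have ha' : (1 : ℝ) ≤ a := by exact_mod_cast ha
  have hV' : (1 : ℝ) ≤ V := by exact_mod_cast hV
  have hI : (Fintype.card (ι × Bool) : ℝ) = 2 * n := by
    rw [Fintype.card_prod, Fintype.card_bool]
    push_cast
    ring
  set L : ℝ := V * Real.log (4 * a * V) with hL
  have hlog4 : Real.log 4 ≤ Real.log (4 * a * V) := by
    apply Real.log_le_log (by norm_num)
    nlinarith
  have hlog0 : 0 < Real.log 4 := Real.log_pos (by norm_num)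
  have hL0 : 0 ≤ L := mul_nonneg (by linarith) (by linarith)
  have hnet := fun j : ℕ => exists_separated_net W
    (show 0 ≤ (1 / 4 : ℝ) ^ j * Fintype.card (ι × Bool) by positivity)
  choose U hUW hsep hcov using hnet
  choose! π hπU hπ using hcov
  -- At scale `(1/4) ^ j` the packing bound is `2 * V * log (4 * a * V * 4 ^ j)`, and each `log 4`
  -- is at most `log (4 * a * V)`.
  have hcard : ∀ j, (#(U j) : ℝ) ≤ Real.exp (2 * L * (1 + j)) := by
    intro j
    rcases Nat.eq_zero_or_pos #(U j) with h0 | h0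
    · rw [h0, Nat.cast_zero]
      exact (Real.exp_pos _).le
    rw [← Real.log_le_iff_le_exp (by exact_mod_cast h0)]
    refine (log_le_of_forall_le_pow (r := (1 / 4 : ℝ) ^ j) ha hV (by positivity)
      (pow_le_one₀ (by norm_num) (by norm_num)) fun k hk hlt => ?_).trans ?_
    · refine card_le_of_separated (U j) (fun p hp => hW p (hUW j hp)) (hsep j) (k := k) ?_ hlt
      intro s
      refine le_trans (Set.encard_le_encard ?_) (hgr k hk s)
      rintro _ ⟨⟨p, hp⟩, rfl⟩
      exact ⟨⟨p, hUW j hp⟩, rfl⟩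
    · have e : Real.log (4 * a * V / (1 / 4 : ℝ) ^ j) = Real.log (4 * a * V) + j * Real.log 4 := by
        rw [one_div, inv_pow, div_inv_eq_mul, Real.log_mul (by positivity) (by positivity),
          Real.log_pow]
      have hj : (0 : ℝ) ≤ j := Nat.cast_nonneg j
      have h1 : j * Real.log 4 ≤ j * Real.log (4 * a * V) := by gcongr
      calc 2 * V * Real.log (4 * a * V / (1 / 4 : ℝ) ^ j)
          ≤ 2 * V * (Real.log (4 * a * V) + j * Real.log (4 * a * V)) := by rw [e]; gcongr
        _ = _ := by rw [hL]; ring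
  let D : (ι × Bool → ℝ) → ι → ℝ := fun p i => p (i, false) - p (i, true)
  -- The links of the chain: the whole difference vector at scale `0`, afterwards the increment from
  -- the approximation in the next coarser net.
  let u : ℕ → (ι × Bool → ℝ) → ι → ℝ := fun j q => Nat.casesOn j (D q) fun j => D q - D (π j q)
  let X : (ι → Bool) → (ι → ℝ) → ℝ := fun σ v => ∑ i, bif σ i then - v i else v i
  have hXsub : ∀ σ v w, X σ (v - w) = X σ v - X σ w := by
    intro σ v w
    simp only [X, ← sum_sub_distrib]
    refine sum_congr rfl fun i _ => ?_
    cases σ i <;> simp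
    ring
  have hsplit : ∀ g : ι × Bool → ℝ, ∑ i, g i = ∑ i, (g (i, true) + g (i, false)) := by
    intro g
    rw [Fintype.sum_prod_type]
    simp
  have hu : ∀ j, ∀ q ∈ U j, ∑ i, u j q i ^ 2 ≤ 16 * Fintype.card ι * (1 / 4) ^ j := by
    intro j q hq
    have hqW := hW q (hUW j hq)
    cases j with
    | zero =>
      have : ∑ i, u 0 q i ^ 2 ≤ ∑ i : ι, (1 : ℝ) := by
        refine sum_le_sum fun i _ => ?_
        have h1 := hqW (i, false)
        have h2 := hqW (i, true)
        change (q (i, false) - q (i, true)) ^ 2 ≤ 1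
        rw [sq_le_one_iff_abs_le_one]
        exact abs_le.2 ⟨by linarith [h1.1, h2.2], by linarith [h1.2, h2.1]⟩
      rw [sum_const, card_univ, nsmul_eq_mul, mul_one] at this
      rw [pow_zero, mul_one]
      linarith
    | succ j =>
      have hpW := hW _ (hUW j (hπU j q (hUW _ hq)))
      have hd := hπ j q (hUW _ hq)
      rw [hsplit, hI] at hd
      have : ∑ i, u (j + 1) q i ^ 2
          ≤ ∑ i, 2 * (|q (i, true) - π j q (i, true)| + |q (i, false) - π j q (i, false)|) := by
        refine sum_le_sum fun i _ => ?_
        change ((q (i, false) - q (i, true)) - (π j q (i, false) - π j q (i, true))) ^ 2 ≤ _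
        have h1 := hqW (i, false)
        have h2 := hqW (i, true)
        have h3 := hpW (i, false)
        have h4 := hpW (i, true)
        have h5 : |q (i, true) - π j q (i, true)| ≤ 1 :=
          abs_le.2 ⟨by linarith [h2.1, h4.2], by linarith [h2.2, h4.1]⟩
        have h6 : |q (i, false) - π j q (i, false)| ≤ 1 :=
          abs_le.2 ⟨by linarith [h1.1, h3.2], by linarith [h1.2, h3.1]⟩
        have e : (q (i, false) - q (i, true)) - (π j q (i, false) - π j q (i, true))
          = (q (i, false) - π j q (i, false)) - (q (i, true) - π j q (i, true)) := by ring
        rw [e]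
        generalize q (i, false) - π j q (i, false) = x at *
        generalize q (i, true) - π j q (i, true) = y at *
        have h7 : (x - y) ^ 2 ≤ 2 * (x ^ 2 + y ^ 2) := by nlinarith [sq_nonneg (x + y)]
        rw [← sq_abs x, ← sq_abs y] at h7
        nlinarith [abs_nonneg x, abs_nonneg y]
      rw [← mul_sum] at this
      rw [pow_succ]
      linarith
  -- As `W` is finite, a fine enough net contains all of `W`, so the chain is finite.
  have hJ : ∃ J : ℕ, ∀ p ∈ W, ∀ q ∈ W, ∑ i, |p i - q i| ≤ (1 / 4 : ℝ) ^ J * (2 * n) → p = q := by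
    have hev : ∀ p ∈ W, ∀ q ∈ W, ∀ᶠ J : ℕ in Filter.atTop,
        ∑ i, |p i - q i| ≤ (1 / 4 : ℝ) ^ J * (2 * n) → p = q := by
      intro p hp q hq
      by_cases hpq : p = q
      · exact Filter.Eventually.of_forall fun _ _ => hpq
      have hpos : 0 < ∑ i, |p i - q i| := by
        obtain ⟨i, hi⟩ := Function.ne_iff.1 hpq
        exact sum_pos' (fun i _ => abs_nonneg _) ⟨i, mem_univ i, abs_pos.2 (sub_ne_zero.2 hi)⟩
      have hlim : Filter.Tendsto (fun J : ℕ => (1 / 4 : ℝ) ^ J * (2 * n)) Filter.atTop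
          (nhds (0 * (2 * n))) :=
        (tendsto_pow_atTop_nhds_zero_of_lt_one (by norm_num) (by norm_num)).mul_const _
      rw [zero_mul] at hlim
      filter_upwards [hlim.eventually (gt_mem_nhds hpos)] with J hJ h
      exact absurd h (not_le.2 hJ)
    have hev' : ∀ᶠ J : ℕ in Filter.atTop, ∀ p ∈ W, ∀ q ∈ W,
        ∑ i, |p i - q i| ≤ (1 / 4 : ℝ) ^ J * (2 * n) → p = q :=
      (W.eventually_all).2 fun p hp => (W.eventually_all).2 fun q hq => hev p hp q hq
    exact hev'.exists
  obtain ⟨J, hJ⟩ := hJ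
  let bad : ℕ → Finset (ι → Bool) := fun j =>
    univ.filter fun σ => ∃ q ∈ U j, n * (ε / 16 * (3 / 4) ^ j) ≤ |X σ (u j q)|
  have hbad : ∀ j, (#(bad j) : ℝ) ≤ 2 ^ Fintype.card ι * (2 * δ * (1 / 8) ^ (j + 1)) := fun j =>
    card_signs_exists_mem_le (U j) (u j) j (hu j) (hcard j) hε hδ hδ1 hn
  have hsub : (univ.filter fun σ : ι → Bool => ∃ p ∈ W, n * (ε / 4) ≤ |X σ (D p)|)
      ⊆ (range (J + 1)).biUnion bad := by
    intro σ hσ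
    by_contra hcon
    simp only [mem_biUnion, mem_range, bad, mem_filter, mem_univ, true_and, not_exists, not_and,
      not_le] at hcon
    -- The right side is `n` times the partial sum of the thresholds `ε / 16 * (3 / 4) ^ j`, whose
    -- total is `ε / 4`.
    have key : ∀ j ≤ J, ∀ q ∈ U j, |X σ (D q)| < n * (ε / 4) * (1 - (3 / 4) ^ (j + 1)) := by
      intro j
      induction j with
      | zero =>
        intro _ q hq
        have := hcon 0 (by omega) q hq
        have e : u 0 q = D q := rfl
        rw [e] at this
        linarith
      | succ j ih =>
        intro hj q hq
        have h1 := hcon (j + 1) (by omega) q hq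
        have h2 := ih (by omega) (π j q) (hπU j q (hUW _ hq))
        have e : u (j + 1) q = D q - D (π j q) := rfl
        rw [e, hXsub] at h1
        have h3 := abs_sub_abs_le_abs_sub (X σ (D q)) (X σ (D (π j q)))
        have e2 : n * (ε / 4) * (1 - (3 / 4) ^ (j + 1 + 1)) = n * (ε / 4) * (1 - (3 / 4) ^ (j + 1))
            + n * (ε / 16 * (3 / 4) ^ (j + 1)) := by ring
        linarith
    obtain ⟨p, hp, hle⟩ := (mem_filter.1 hσ).2
    have hpU : p ∈ U J := by
      have h1 := hπ J p hp
      rw [hI] at h1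
      have := hJ p hp (π J p) (hUW J (hπU J p hp)) h1
      rw [this]
      exact hπU J p hp
    have h1 := key J le_rfl p hpU
    have h2 : 0 ≤ n * (ε / 4) * (3 / 4) ^ (J + 1) := by positivity
    linarith
  have h1 : (#{σ : ι → Bool | ∃ p ∈ W, n * (ε / 4) ≤ |X σ (D p)|} : ℝ)
      ≤ ∑ j ∈ range (J + 1), (#(bad j) : ℝ) := by
    exact_mod_cast (card_le_card hsub).trans card_biUnion_le
  refine (h1.trans (sum_le_sum fun j _ => hbad j)).trans ?_
  rw [← mul_sum, ← mul_sum]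
  gcongr
  -- The failure probabilities add up to at most `2 * δ / 7 ≤ δ / 2`.
  have hgeo : ∀ K : ℕ, ∑ j ∈ range K, (1 / 8 : ℝ) ^ (j + 1) = (1 - (1 / 8) ^ K) / 7 := by
    intro K
    induction K with
    | zero => simp
    | succ K ih => rw [sum_range_succ, ih]; ring
  rw [hgeo]
  have : (0 : ℝ) ≤ (1 / 8) ^ (J + 1) := by positivity
  nlinarith

/-! ### Symmetrization and uniform convergence -/

/-- If every section of `A'` over a point of `A` has probability at least `1/2`, then `A'` has at
least half the outer measure of `A`. -/
theorem measure_le_two_mul_prod {Ω Ω' : Type*} [MeasurableSpace Ω] [MeasurableSpace Ω']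
    (μ : Measure Ω) (ν : Measure Ω') [SFinite ν] {A : Set Ω} {A' : Set (Ω × Ω')}
    (h : ∀ S ∈ A, 1 / 2 ≤ ν {S' | (S, S') ∈ A'}) : μ A ≤ 2 * (μ.prod ν) A' := by
  -- Neither set need be measurable: Fubini and Markov are applied to a measurable hull of `A'`,
  -- whose sections are only larger.
  have hE := measurableSet_toMeasurable (μ.prod ν) A'
  have h1 : (1 / 2 : ENNReal) * μ A ≤ (μ.prod ν) A' := by
    rw [← measure_toMeasurable A', Measure.prod_apply hE]
    refine le_trans ?_ (mul_meas_ge_le_lintegral (measurable_measure_prodMk_left hE) (1 / 2))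
    gcongr
    intro S hS
    exact (h S hS).trans (measure_mono fun S' hS' => subset_toMeasurable _ _ hS')
  calc μ A = 2 * (1 / 2 * μ A) := by
        rw [← mul_assoc, one_div, ENNReal.mul_inv_cancel (by simp) (by simp), one_mul]
    _ ≤ _ := by gcongr

/-- Chebyshev's inequality for the mean of a `[0, 1]`-valued function on a sample. -/
theorem half_le_measure_abs_mean_sub_lt {Z : Type*} [MeasurableSpace Z] (D : Measure Z)
    [IsProbabilityMeasure D] {φ : Z → ℝ} (hφ : Measurable φ)
    (hφ01 : ∀ z, φ z ∈ Set.Icc (0 : ℝ) 1) {n : ℕ} {ε : ℝ} (hε : 0 < ε) (hn : 8 ≤ n * ε ^ 2) :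
    1 / 2 ≤ (Measure.pi fun _ : Fin n => D) {S | |∑ i, φ (S i) - n * ∫ z, φ z ∂D| < n * (ε / 4)} := by
  set μ := Measure.pi fun _ : Fin n => D with hμ
  have hn0 : (0 : ℝ) < n := by
    by_contra hcon
    have : (n : ℝ) = 0 := le_antisymm (not_lt.1 hcon) (Nat.cast_nonneg n)
    rw [this] at hn
    linarith
  have hLp : MemLp φ 2 D := memLp_of_bounded (Filter.Eventually.of_forall hφ01)
    hφ.aestronglyMeasurable 2
  have hLp' : MemLp (∑ i : Fin n, fun S : Fin n → Z => φ (S i)) 2 μ :=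
    memLp_finsetSum' _ fun i _ => hLp.comp_measurePreserving (measurePreserving_eval _ i)
  have hvar : ProbabilityTheory.variance (∑ i : Fin n, fun S : Fin n → Z => φ (S i)) μ ≤ n / 4 := by
    rw [hμ, ProbabilityTheory.variance_sum_pi (X := fun _ : Fin n => φ) (fun _ => hLp)]
    have := ProbabilityTheory.variance_le_sq_of_bounded (μ := D)
      (Filter.Eventually.of_forall hφ01) hφ.aemeasurable
    rw [Finset.sum_const, Finset.card_univ, Fintype.card_fin, nsmul_eq_mul]
    nlinarith
  have hexp : ∫ S, (∑ i : Fin n, fun S : Fin n → Z => φ (S i)) S ∂μ = n * ∫ z, φ z ∂D := by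
    simp only [Finset.sum_apply]
    rw [integral_finsetSum]
    · have : ∀ i : Fin n, ∫ S, φ (S i) ∂μ = ∫ z, φ z ∂D := fun i =>
        integral_comp_eval (μ := fun _ : Fin n => D) (i := i) hφ.aestronglyMeasurable
      simp [this]
    · exact fun i _ => (hLp.comp_measurePreserving (measurePreserving_eval _ i)).integrable
        (by norm_num)
  have hc : 0 < n * (ε / 4) := by positivity
  have hcheb := ProbabilityTheory.meas_ge_le_variance_div_sq hLp' hc
  rw [hexp] at hcheb
  simp only [Finset.sum_apply] at hcheb
  -- The ratio is at most `(n / 4) / (n * ε / 4) ^ 2 = 4 / (n * ε ^ 2)`, whence the requirement `8 ≤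
  -- n * ε ^ 2`.
  have hle : ENNReal.ofReal (ProbabilityTheory.variance
      (∑ i : Fin n, fun S : Fin n → Z => φ (S i)) μ / (n * (ε / 4)) ^ 2) ≤ 1 / 2 := by
    rw [show (1 / 2 : ENNReal) = ENNReal.ofReal (1 / 2) by
      rw [ENNReal.ofReal_div_of_pos two_pos]; simp]
    apply ENNReal.ofReal_le_ofReal
    rw [div_le_iff₀ (by positivity)]
    nlinarith
  have hmeas : MeasurableSet {S : Fin n → Z | |∑ i, φ (S i) - n * ∫ z, φ z ∂D| < n * (ε / 4)} :=
    measurableSet_lt (by fun_prop) measurable_const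
  have hcompl := prob_compl_eq_one_sub (μ := μ) hmeas
  have e : {S : Fin n → Z | |∑ i, φ (S i) - n * ∫ z, φ z ∂D| < n * (ε / 4)}ᶜ
      = {S : Fin n → Z | n * (ε / 4) ≤ |∑ i, φ (S i) - n * ∫ z, φ z ∂D|} := by
    ext S
    simp
  rw [e] at hcompl
  have h1 := hcheb.trans hle
  rw [hcompl, tsub_le_iff_right] at h1
  calc (1 / 2 : ENNReal) = 1 - 1 / 2 := (ENNReal.sub_half ENNReal.one_ne_top).symm
    _ ≤ _ := tsub_le_iff_left.2 h1

/-- The tail bound for the symmetrized process of a permissible class of polynomial growth. -/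
theorem measure_exists_le_abs_sum_sub_le {Θ Z : Type*} [MeasurableSpace Θ] [StandardBorelSpace Θ]
    [MeasurableSpace Z] (G : Θ → Z → ℝ) (hG : Measurable fun p : Θ × Z => G p.1 p.2)
    (hG01 : ∀ θ z, G θ z ∈ Set.Icc (0 : ℝ) 1) {a V : ℕ} (ha : 1 ≤ a) (hV : 1 ≤ V)
    (hgr : ∀ k : ℕ, 1 ≤ k → ∀ ζ : Fin k → Z,
      (Set.range fun θ j => G θ (ζ j)).encard ≤ ((a * k + 1) ^ V : ℕ))
    (D : Measure Z) [IsProbabilityMeasure D] {n : ℕ} (hn0 : 0 < n) {ε δ : ℝ}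
    (hε : 0 ≤ ε) (hδ : 0 < δ) (hδ1 : δ ≤ 1)
    (hn : 8192 * (2 * (V * Real.log (4 * a * V)) + Real.log (1 / δ) + 3) ≤ n * ε ^ 2) :
    (Measure.pi fun _ : Fin n => D.prod D)
      {ω | ∃ θ, n * (ε / 4) ≤ |∑ i, (G θ (ω i).1 - G θ (ω i).2)|} ≤ ENNReal.ofReal (δ / 2) := by
  classical
  set ν := Measure.pi fun _ : Fin n => D.prod D with hν
  let B : Set (Θ × (Fin n → Z × Z)) :=
    {p | n * (ε / 4) ≤ |∑ i, (G p.1 (p.2 i).1 - G p.1 (p.2 i).2)|}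
  have hBmeas : MeasurableSet B := by
    refine measurableSet_le measurable_const (Measurable.abs ?_)
    refine Finset.measurable_sum _ fun i _ => ?_
    exact (hG.comp (f := fun p : Θ × (Fin n → Z × Z) => (p.1, (p.2 i).1)) (by fun_prop)).sub
      (hG.comp (f := fun p : Θ × (Fin n → Z × Z) => (p.1, (p.2 i).2)) (by fun_prop))
  have hset : {ω | ∃ θ, n * (ε / 4) ≤ |∑ i, (G θ (ω i).1 - G θ (ω i).2)|} = Prod.snd '' B := by
    ext ω
    simp [B]
  rw [hset]
  -- The averaging over swaps below needs a measurable event, so each `η` below the outer measure is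
  -- bounded through a measurable subset `A` of the projection.
  refine le_of_forall_lt_imp_le_of_dense fun η hη => ?_
  obtain ⟨A, hAB, hA, hηA⟩ := exists_measurableSet_subset_snd_image ν hBmeas hη
  refine hηA.trans ?_
  rw [← hset] at hAB
  -- Exchanging the two halves of a pair preserves `ν` and flips the sign of one summand. Hence `ν
  -- A` is the average over all swaps, and for a fixed double sample only the counting of signs
  -- remains.
  let sw : (Fin n → Bool) → (Fin n → Z × Z) → Fin n → Z × Z :=
    fun σ ω i => bif σ i then (ω i).swap else ω i
  have hsw : ∀ σ, MeasurePreserving (sw σ) ν ν := by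
    intro σ
    refine measurePreserving_pi (f := fun i (p : Z × Z) => bif σ i then p.swap else p) _ _ fun i => ?_
    cases σ i
    · exact MeasurePreserving.id _
    · exact Measure.measurePreserving_swap
  have : Nonempty (Fin n) := ⟨⟨0, hn0⟩⟩
  have hpt : ∀ ω, ∑ σ : Fin n → Bool, (sw σ ⁻¹' A).indicator (1 : (Fin n → Z × Z) → ENNReal) ω
      ≤ 2 ^ n * ENNReal.ofReal (δ / 2) := by
    intro ω
    let zz : Fin n × Bool → Z := fun i => bif i.2 then (ω i.1).2 else (ω i.1).1
    let P : Set (Fin n × Bool → ℝ) := Set.range fun θ i => G θ (zz i)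
    have hfin : P.Finite := by
      let e := Fintype.equivFin (Fin n × Bool)
      have h1 : (Set.range fun θ j => G θ (zz (e.symm j))).Finite :=
        Set.finite_of_encard_le_coe (hgr _ Fintype.card_pos _)
      refine (h1.image fun v i => v (e i)).subset ?_
      rintro _ ⟨θ, rfl⟩
      refine ⟨_, ⟨θ, rfl⟩, ?_⟩
      simp
    have hcard := card_signs_exists_le hfin.toFinset ?_ ha hV ?_ hε hδ hδ1
      (by simpa [Fintype.card_fin] using hn)
    · rw [Fintype.card_fin] at hcard
      have hle : ∑ σ : Fin n → Bool, (sw σ ⁻¹' A).indicator (1 : (Fin n → Z × Z) → ENNReal) ω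
          = ((Finset.univ.filter fun σ => sw σ ω ∈ A).card : ENNReal) := by
        rw [Finset.card_filter]
        push_cast
        refine Finset.sum_congr rfl fun σ _ => ?_
        rw [Set.indicator_apply]
        rfl
      rw [hle]
      have h2 : (2 : ENNReal) ^ n * ENNReal.ofReal (δ / 2) = ENNReal.ofReal (2 ^ n * (δ / 2)) := by
        rw [ENNReal.ofReal_mul (by positivity), ENNReal.ofReal_pow (by norm_num)]
        simp
      rw [h2, ← ENNReal.ofReal_natCast]
      refine ENNReal.ofReal_le_ofReal (le_trans ?_ hcard)
      refine Nat.cast_le.2 (Finset.card_le_card fun σ hσ => ?_)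
      rw [Finset.mem_filter] at hσ ⊢
      refine ⟨Finset.mem_univ _, ?_⟩
      obtain ⟨θ, hθ⟩ := hAB hσ.2
      refine ⟨fun i => G θ (zz i), hfin.mem_toFinset.2 ⟨θ, rfl⟩, ?_⟩
      convert hθ using 3
      rename_i i _
      simp only [sw, zz]
      cases σ i <;> simp
    · intro p hp
      obtain ⟨θ, rfl⟩ := hfin.mem_toFinset.1 hp
      exact fun i => hG01 θ _
    · intro k hk s
      refine le_trans (Set.encard_le_encard ?_) (hgr k hk fun j => zz (s j))
      rintro _ ⟨⟨p, hp⟩, rfl⟩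
      obtain ⟨θ, rfl⟩ := hfin.mem_toFinset.1 hp
      exact ⟨θ, rfl⟩
  have hsum : (2 : ENNReal) ^ n * ν A ≤ 2 ^ n * ENNReal.ofReal (δ / 2) := by
    calc (2 : ENNReal) ^ n * ν A = ∑ σ : Fin n → Bool, ν (sw σ ⁻¹' A) := by
          simp [(hsw _).measure_preimage hA.nullMeasurableSet]
      _ = ∫⁻ ω, ∑ σ : Fin n → Bool, (sw σ ⁻¹' A).indicator 1 ω ∂ν := by
          rw [lintegral_finsetSum]
          · exact Finset.sum_congr rfl fun σ _ =>
              (lintegral_indicator_one ((hsw σ).measurable hA)).symm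
          · exact fun σ _ => measurable_one.indicator ((hsw σ).measurable hA)
      _ ≤ ∫⁻ _, 2 ^ n * ENNReal.ofReal (δ / 2) ∂ν := lintegral_mono hpt
      _ = _ := by simp
  exact (ENNReal.mul_le_mul_iff_right (by simp) (by simp)).1 hsum

/-- Uniform convergence, without a logarithmic factor in `ε`, for a permissible class of
`[0, 1]`-valued functions of polynomial growth. -/
theorem measure_exists_lt_abs_integral_sub_mean_le {Θ Z : Type*} [MeasurableSpace Θ]
    [StandardBorelSpace Θ]
    [MeasurableSpace Z] (G : Θ → Z → ℝ) (hG : Measurable fun p : Θ × Z => G p.1 p.2)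
    (hG01 : ∀ θ z, G θ z ∈ Set.Icc (0 : ℝ) 1) {a V : ℕ} (ha : 1 ≤ a) (hV : 1 ≤ V)
    (hgr : ∀ k : ℕ, 1 ≤ k → ∀ ζ : Fin k → Z,
      (Set.range fun θ j => G θ (ζ j)).encard ≤ ((a * k + 1) ^ V : ℕ))
    (D : Measure Z) [IsProbabilityMeasure D] {n : ℕ} {ε δ : ℝ}
    (hε : 0 < ε) (hδ : 0 < δ) (hδ1 : δ ≤ 1)
    (hn : 8192 * (2 * (V * Real.log (4 * a * V)) + Real.log (1 / δ) + 3) ≤ n * ε ^ 2) :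
    (Measure.pi fun _ : Fin n => D)
      {S | ∃ θ, ε / 2 < |∫ z, G θ z ∂D - (∑ i, G θ (S i)) / n|} ≤ ENNReal.ofReal δ := by
  have ha' : (1 : ℝ) ≤ a := by exact_mod_cast ha
  have hV' : (1 : ℝ) ≤ V := by exact_mod_cast hV
  have hlog : 0 ≤ V * Real.log (4 * a * V) :=
    mul_nonneg (by linarith) (Real.log_nonneg (by nlinarith))
  have hlogδ : 0 ≤ Real.log (1 / δ) := Real.log_nonneg (by rw [le_div_iff₀ hδ]; linarith)
  have hn8 : 8 ≤ n * ε ^ 2 := by linarith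
  have hn0 : 0 < n := by
    rcases Nat.eq_zero_or_pos n with rfl | h
    · norm_num at hn8
    · exact h
  have hn0' : (0 : ℝ) < n := by exact_mod_cast hn0
  have hsym := measure_exists_le_abs_sum_sub_le G hG hG01 ha hV hgr D hn0 hε.le hδ hδ1 hn
  have hmp := measurePreserving_arrowProdEquivProdArrow Z Z (Fin n) (fun _ => D) (fun _ => D)
  let A' : Set ((Fin n → Z) × (Fin n → Z)) :=
    {p | ∃ θ, n * (ε / 4) ≤ |∑ i, (G θ (p.1 i) - G θ (p.2 i))|}
  have h1 : ((Measure.pi fun _ : Fin n => D).prod (Measure.pi fun _ : Fin n => D)) A'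
      ≤ ENNReal.ofReal (δ / 2) := by
    rw [← hmp.measure_preimage_equiv]
    exact hsym
  -- Ghost sample: if `S` misses the mean by more than `ε / 2` for some `θ`, a second sample is
  -- within `ε / 4` of it with probability at least `1/2`, and then the two samples differ by at
  -- least `ε / 4`. The lost factor `2` turns `δ / 2` into `δ`.
  refine (measure_le_two_mul_prod (A' := A') _ (Measure.pi fun _ : Fin n => D) ?_).trans
    ((mul_le_mul_right h1 2).trans ?_)
  · rintro S ⟨θ, hθ⟩
    refine (half_le_measure_abs_mean_sub_lt D (hG.comp measurable_prodMk_left : Measurable (G θ))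
      (hG01 θ) hε hn8).trans (measure_mono fun S' hS' => ⟨θ, ?_⟩)
    have hS'' : |∑ i, G θ (S' i) - n * ∫ z, G θ z ∂D| < n * (ε / 4) := hS'
    have h2 : n * (ε / 2) < |n * ∫ z, G θ z ∂D - ∑ i, G θ (S i)| := by
      have e : n * ∫ z, G θ z ∂D - ∑ i, G θ (S i)
          = n * (∫ z, G θ z ∂D - (∑ i, G θ (S i)) / n) := by field_simp
      rw [e, abs_mul, abs_of_pos hn0']
      gcongr
    rw [Finset.sum_sub_distrib]
    have h3 := abs_sub_le (n * ∫ z, G θ z ∂D) (∑ i, G θ (S' i)) (∑ i, G θ (S i))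
    rw [abs_sub_comm (n * ∫ z, G θ z ∂D) (∑ i, G θ (S' i)),
      abs_sub_comm (∑ i, G θ (S' i)) (∑ i, G θ (S i))] at h3
    linarith
  · rw [show (2 : ENNReal) = ENNReal.ofReal 2 by simp, ← ENNReal.ofReal_mul zero_le_two]
    exact ENNReal.ofReal_le_ofReal (by linarith)

/-! ### Rounding, thresholds and the Sauer-Shelah bound -/

/-- The values of the thresholds `(j + 1/2) / m` determine the rounded value. -/
theorem roundGrid_eq_of_forall {m : ℕ} {r r' : ℝ}
    (h : ∀ j : Fin m, (j : ℝ) + 1 / 2 ≤ m * r ↔ (j : ℝ) + 1 / 2 ≤ m * r') :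
    roundGrid m r = roundGrid m r' := by
  have hround : ∀ (s : ℝ) (j : ℕ), (j : ℝ) + 1 / 2 ≤ s ↔ (j : ℤ) + 1 ≤ round s := by
    intro s j
    rw [round_eq, Int.le_floor]
    push_cast
    constructor <;> intro h <;> linarith
  have key : ∀ p q : ℤ, (∀ j : Fin m, (j : ℤ) + 1 ≤ p → (j : ℤ) + 1 ≤ q) →
      max 0 (min (m : ℤ) p) ≤ max 0 (min (m : ℤ) q) := by
    intro p q hpq
    rcases le_or_gt (min (m : ℤ) p) 0 with h0 | h0
    · omega
    · have := hpq ⟨(min (m : ℤ) p - 1).toNat, by omega⟩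
      simp only at this
      omega
  unfold roundGrid
  congr 2
  refine le_antisymm (key _ _ fun j hj => ?_) (key _ _ fun j hj => ?_)
  · exact (hround _ _).1 ((h j).1 ((hround _ _).2 hj))
  · exact (hround _ _).1 ((h j).2 ((hround _ _).2 hj))

/-- Puts the Sauer-Shelah sum into the form of a power; the induction works because the new term is
at most `N * (N + 1) ^ v`. -/
theorem sum_choose_le_pow (N v : ℕ) : ∑ i ∈ Finset.Iic v, N.choose i ≤ (N + 1) ^ v := by
  have e : Finset.Iic v = Finset.range (v + 1) := by
    ext
    simp
  rw [e]
  induction v with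
  | zero => simp
  | succ v ih =>
    rw [Finset.sum_range_succ]
    have h1 : N.choose (v + 1) ≤ N * (N + 1) ^ v := by
      refine (Nat.choose_le_pow N (v + 1)).trans ?_
      rw [pow_succ, mul_comm]
      gcongr
      omega
    calc _ ≤ (N + 1) ^ v + N * (N + 1) ^ v := add_le_add (ih (by ext; simp)) h1
      _ = _ := by ring

open Finset in
/-- A finite set of thresholds that `H` shatters with weak inequalities has at most as many elements
as the pseudodimension. -/
theorem card_le_of_shatters {X : Type*} {H : Set (X → ℝ)} {d : ℕ} (hd : HasPseudodimension H d)
    {β : Type*} (s : Finset β) (x : β → X) (y : β → ℝ)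
    (hs : ∀ t ⊆ s, ∃ h ∈ H, ∀ p ∈ s, y p ≤ h (x p) ↔ p ∈ t) : #s ≤ d := by
  classical
  have h1 : ∀ b : Fin #s → Bool, ∃ h ∈ H, ∀ i, y (s.equivFin.symm i) ≤ h (x (s.equivFin.symm i))
      ↔ b i = true := by
    intro b
    obtain ⟨h, hH, hh⟩ := hs ((univ.filter fun i => b i = true).map
      (s.equivFin.symm.toEmbedding.trans (Function.Embedding.subtype _))) (by
        intro p hp
        simp only [mem_map] at hp
        obtain ⟨i, _, rfl⟩ := hp
        exact (s.equivFin.symm i).2)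
    refine ⟨h, hH, fun i => ?_⟩
    rw [hh _ (s.equivFin.symm i).2]
    constructor
    · intro hp
      rw [mem_map] at hp
      obtain ⟨j, hj, hji⟩ := hp
      have : j = i := s.equivFin.symm.injective (Subtype.ext hji)
      rw [← this]
      exact (mem_filter.1 hj).2
    · intro hi
      exact mem_map.2 ⟨i, mem_filter.2 ⟨mem_univ _, hi⟩, rfl⟩
  choose h hH hh using h1
  -- Pseudo-shattering uses strict inequalities. Only finitely many functions `h b` are involved, so
  -- each threshold can be lowered to some `c` without any of their values falling strictly between;
  -- then `y ≤ h b x` and `c < h b x` agree.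
  have h2 : ∀ i : Fin #s, ∃ c < y (s.equivFin.symm i), ∀ b : Fin #s → Bool,
      h b (x (s.equivFin.symm i)) < y (s.equivFin.symm i) → h b (x (s.equivFin.symm i)) ≤ c := by
    intro i
    have h3 : ∀ᶠ c in nhdsWithin (y (s.equivFin.symm i)) (Set.Iio (y (s.equivFin.symm i))),
        c < y (s.equivFin.symm i) := self_mem_nhdsWithin
    have h4 : ∀ᶠ c in nhdsWithin (y (s.equivFin.symm i)) (Set.Iio (y (s.equivFin.symm i))),
        ∀ b : Fin #s → Bool, h b (x (s.equivFin.symm i)) < y (s.equivFin.symm i) →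
          h b (x (s.equivFin.symm i)) ≤ c := by
      rw [Filter.eventually_all]
      intro b
      by_cases hb : h b (x (s.equivFin.symm i)) < y (s.equivFin.symm i)
      · filter_upwards [mem_nhdsWithin_of_mem_nhds (Ioi_mem_nhds hb)] with c hc _
        exact (Set.mem_Ioi.1 hc).le
      · exact Filter.Eventually.of_forall fun c hb' => absurd hb' hb
    exact (h3.and h4).exists
  choose c hc hc' using h2
  refine hd.2 ⟨fun i => x (s.equivFin.symm i), c, fun b => ⟨h b, hH b, fun i => ?_⟩⟩
  rw [← hh b i]
  constructor
  · intro hlt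
    by_contra hcon
    exact absurd (hc' i b (not_le.1 hcon)) (not_le.2 hlt)
  · intro hle
    exact (hc i).trans_le hle

open Finset in
/-- The Sauer-Shelah bound for the rounded functions of a class of finite pseudodimension. -/
theorem encard_range_roundGrid_le {X : Type*} {H : Set (X → ℝ)} {d : ℕ}
    (hd : HasPseudodimension H d) {m : ℕ} (hm : 0 < m) {k : ℕ} (x : Fin k → X) :
    (Set.range fun (h : H) i => roundGrid m (h.1 (x i))).encard ≤ ((m * k + 1) ^ d : ℕ) := by
  classical
  have hm' : (0 : ℝ) < m := by exact_mod_cast hm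
  -- The pairs (point, threshold) that `h` reaches. The family of these sets lives on `k * m`
  -- elements and has VC dimension at most `d`.
  let pat : H → Finset (Fin k × Fin m) := fun h =>
    univ.filter fun p => (p.2 : ℝ) + 1 / 2 ≤ m * h.1 (x p.1)
  let 𝒜 : Finset (Finset (Fin k × Fin m)) := univ.filter fun s => ∃ h, pat h = s
  have hfac : (fun (h : H) i => roundGrid m (h.1 (x i))).FactorsThrough pat := by
    intro h h' e
    funext i
    refine roundGrid_eq_of_forall fun j => ?_
    have := Finset.ext_iff.1 e (i, j)
    simpa [pat] using this
  have h1 : (Set.range fun (h : H) i => roundGrid m (h.1 (x i))).encard ≤ (#𝒜 : ℕ) := by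
    have hsub : (Set.range fun (h : H) i => roundGrid m (h.1 (x i)))
        ⊆ Function.extend pat (fun (h : H) i => roundGrid m (h.1 (x i))) 0 '' (𝒜 : Set _) := by
      rintro _ ⟨h, rfl⟩
      exact ⟨pat h, mem_coe.2 (mem_filter.2 ⟨mem_univ _, h, rfl⟩), hfac.extend_apply 0 h⟩
    refine (Set.encard_le_encard hsub).trans ((Set.encard_image_le _ _).trans ?_)
    rw [Set.encard_coe_eq_coe_finsetCard]
  refine h1.trans (Nat.cast_le.2 ?_)
  have hvc : 𝒜.vcDim ≤ d := by
    refine Finset.sup_le fun s hs => ?_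
    rw [mem_shatterer] at hs
    refine card_le_of_shatters hd s (fun p => x p.1) (fun p => ((p.2 : ℝ) + 1 / 2) / m)
      fun t ht => ?_
    obtain ⟨u, hu, hut⟩ := hs ht
    obtain ⟨h, rfl⟩ := (mem_filter.1 hu).2
    refine ⟨h.1, h.2, fun p hp => ?_⟩
    rw [div_le_iff₀ hm', mul_comm, ← hut, mem_inter]
    simp [pat, hp]
  have h2 := (card_le_card_shatterer 𝒜).trans
    ((card_shatterer_le_sum_vcDim (𝒜 := 𝒜)).trans (sum_choose_le_pow _ _))
  refine h2.trans ?_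
  rw [Fintype.card_prod, Fintype.card_fin, Fintype.card_fin, mul_comm k m]
  exact Nat.pow_le_pow_right (Nat.succ_pos _) hvc

/-! ### Iterates of the algorithm and their growth function -/

/-- The models of LSBoost when the functions used in round `t` are `h t 0, …, h t m`. -/
def boostIter {X : Type*} (m : ℕ) (f : X → ℝ) (h : ℕ → ℕ → X → ℝ) : ℕ → X → ℝ
  | 0 => fun x => roundGrid m (f x)
  | t + 1 => fun x => roundGrid m
      (∑ k ∈ Finset.range (m + 1), Set.indicator {x' | boostIter m f h t x' = (k : ℝ) / m} (h t k) x)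

theorem exists_boostIter_eq {X : Type*} (m : ℕ) (f : X → ℝ) (h : ℕ → ℕ → X → ℝ) (t : ℕ) (x : X) :
    ∃ k ≤ m, boostIter m f h t x = (k : ℝ) / m := by
  cases t <;> exact roundGrid_mem m _

/-- Distinct grid points have disjoint level sets, so a single summand survives. -/
theorem boostIter_succ {X : Type*} {m : ℕ} (hm : 0 < m) (f : X → ℝ) (h : ℕ → ℕ → X → ℝ) {t : ℕ}
    {x : X} {k : ℕ} (hk : k ≤ m) (hx : boostIter m f h t x = (k : ℝ) / m) :
    boostIter m f h (t + 1) x = roundGrid m (h t k x) := by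
  have hm' : (m : ℝ) ≠ 0 := by exact_mod_cast hm.ne'
  change roundGrid m _ = _
  congr 1
  rw [Finset.sum_eq_single_of_mem k (Finset.mem_range.2 (Nat.lt_succ_of_le hk))]
  · exact Set.indicator_of_mem (s := {x' | boostIter m f h t x' = (k : ℝ) / m}) hx _
  · intro j _ hj
    refine Set.indicator_of_notMem ?_ _
    intro (hj' : boostIter m f h t x = (j : ℝ) / m)
    rw [hx, div_left_inj' hm'] at hj'
    exact hj (by exact_mod_cast hj'.symm)

theorem boostIter_mem_Icc {X : Type*} (m : ℕ) (f : X → ℝ) (h : ℕ → ℕ → X → ℝ) (t : ℕ) (x : X) :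
    boostIter m f h t x ∈ Set.Icc (0 : ℝ) 1 := by
  obtain ⟨k, hk, e⟩ := exists_boostIter_eq m f h t x
  rw [e]
  exact ⟨by positivity, div_le_one_of_le₀ (by exact_mod_cast hk) (Nat.cast_nonneg _)⟩

theorem measurable_roundGrid (m : ℕ) : Measurable (roundGrid m) := by
  have h1 : Measurable fun r : ℝ => round ((m : ℝ) * r) := by
    simp_rw [round_eq]
    exact Int.measurable_floor.comp (by fun_prop)
  have h2 : Measurable fun p : ℤ => ((max 0 (min (m : ℤ) p) : ℤ) : ℝ) / m := measurable_of_countable _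
  exact h2.comp h1

/-- The choices of all rounds are indexed by `ℕ → ℕ → Θ`, a countable product and so standard Borel
whenever `Θ` is; joint measurability makes the iterates a permissible class. -/
theorem measurable_boostIter {Θ X : Type*} [MeasurableSpace Θ] [MeasurableSpace X]
    {g : Θ → X → ℝ} (hg : Measurable fun p : Θ × X => g p.1 p.2) (m : ℕ) {f : X → ℝ}
    (hf : Measurable f) (t : ℕ) :
    Measurable fun p : (ℕ → ℕ → Θ) × X => boostIter m f (fun s k => g (p.1 s k)) t p.2 := by
  induction t with
  | zero => exact (measurable_roundGrid m).comp (hf.comp measurable_snd)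
  | succ t ih =>
    refine (measurable_roundGrid m).comp (Finset.measurable_sum _ fun k _ => ?_)
    have h1 : Measurable fun p : (ℕ → ℕ → Θ) × X => g (p.1 t k) p.2 :=
      hg.comp (f := fun p : (ℕ → ℕ → Θ) × X => (p.1 t k, p.2)) (by fun_prop)
    exact h1.indicator (ih (measurableSet_singleton ((k : ℝ) / m)))

open Finset in
/-- The number of patterns of the models of LSBoost after `t` rounds. -/
theorem exists_finset_boostIter_mem {X : Type*} {H : Set (X → ℝ)} {d : ℕ}
    (hd : HasPseudodimension H d) {m : ℕ} (hm : 0 < m) (f : X → ℝ) {k : ℕ} (x : Fin k → X) (t : ℕ) :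
    ∃ Q : Finset (Fin k → ℝ), #Q ≤ (m * k + 1) ^ (d * (m + 1) * t) ∧
      ∀ h : ℕ → ℕ → X → ℝ, (∀ s j, h s j ∈ H) → (fun i => boostIter m f h t (x i)) ∈ Q := by
  classical
  have hm' : (m : ℝ) ≠ 0 := by exact_mod_cast hm.ne'
  have hR := encard_range_roundGrid_le hd hm x
  have hfin := Set.finite_of_encard_le_coe hR
  have hRcard : #hfin.toFinset ≤ (m * k + 1) ^ d := by
    rw [hfin.encard_eq_coe_toFinset_card] at hR
    exact_mod_cast hR
  induction t with
  | zero => exact ⟨{fun i => roundGrid m (f (x i))}, by simp, fun h _ => by simp [boostIter]⟩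
  | succ t ih =>
    obtain ⟨Q, hQ, hmem⟩ := ih
    -- The new pattern is computed from the old one and the `m + 1` rounded patterns of the
    -- functions used, so a round multiplies the count by at most `((m * k + 1) ^ d) ^ (m + 1)`.
    let Φ : (Fin k → ℝ) × (Fin (m + 1) → Fin k → ℝ) → Fin k → ℝ := fun p i =>
      ∑ j : Fin (m + 1), if p.1 i = (j : ℝ) / m then p.2 j i else 0
    refine ⟨(Q ×ˢ Fintype.piFinset fun _ : Fin (m + 1) => hfin.toFinset).image Φ, ?_, ?_⟩
    · refine card_image_le.trans ?_
      rw [card_product, Fintype.card_piFinset, prod_const, card_univ, Fintype.card_fin]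
      calc _ ≤ (m * k + 1) ^ (d * (m + 1) * t) * ((m * k + 1) ^ d) ^ (m + 1) := by gcongr
        _ = _ := by rw [← pow_mul, ← pow_add]; ring_nf
    · intro h hH
      refine mem_image.2 ⟨(fun i => boostIter m f h t (x i),
        fun j i => roundGrid m (h t j (x i))), ?_, ?_⟩
      · refine mem_product.2 ⟨hmem h hH, Fintype.mem_piFinset.2 fun j => hfin.mem_toFinset.2 ?_⟩
        exact ⟨⟨h t j, hH t j⟩, rfl⟩
      · funext i
        obtain ⟨l, hl, e⟩ := exists_boostIter_eq m f h t (x i)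
        rw [boostIter_succ hm f h hl e]
        simp only [Φ, e]
        rw [sum_eq_single_of_mem ⟨l, Nat.lt_succ_of_le hl⟩ (mem_univ _)]
        · simp
        · intro j _ hj
          rw [if_neg]
          intro hj'
          rw [div_left_inj' hm'] at hj'
          exact hj (Fin.ext (by exact_mod_cast hj'.symm))

open Finset in
/-- The growth function of the class of all models of LSBoost with at most `m` rounds. -/
theorem encard_range_boostIter_le {Θ X : Type*} (g : Θ → X → ℝ) {d : ℕ}
    (hd : HasPseudodimension (Set.range g) d) {m : ℕ} (hm : 0 < m) (f : X → ℝ) {k : ℕ} (hk : 1 ≤ k)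
    (x : Fin k → X) :
    (Set.range fun (p : Fin (m + 1) × (ℕ → ℕ → Θ)) i =>
        boostIter m f (fun s j => g (p.2 s j)) p.1 (x i)).encard
      ≤ ((m * k + 1) ^ (d * (m + 1) * m + 1) : ℕ) := by
  classical
  choose Q hQ hmem using exists_finset_boostIter_mem hd hm f x
  have hsub : (Set.range fun (p : Fin (m + 1) × (ℕ → ℕ → Θ)) i =>
      boostIter m f (fun s j => g (p.2 s j)) p.1 (x i)) ⊆ ((range (m + 1)).biUnion Q : Finset _) := by
    rintro _ ⟨⟨t, θ⟩, rfl⟩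
    rw [mem_coe, mem_biUnion]
    exact ⟨t, mem_range.2 t.2, hmem t _ fun s j => ⟨θ s j, rfl⟩⟩
  refine (Set.encard_le_encard hsub).trans ?_
  rw [Set.encard_coe_eq_coe_finsetCard]
  refine Nat.cast_le.2 (card_biUnion_le.trans ?_)
  calc ∑ t ∈ range (m + 1), #(Q t) ≤ ∑ t ∈ range (m + 1), (m * k + 1) ^ (d * (m + 1) * m) := by
        refine sum_le_sum fun t ht => (hQ t).trans ?_
        refine Nat.pow_le_pow_right (Nat.succ_pos _) ?_
        have := mem_range.1 ht
        gcongr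
        omega
    _ = (m + 1) * (m * k + 1) ^ (d * (m + 1) * m) := by simp
    -- The extra `1` in the exponent pays for the `m + 1` possible numbers of rounds; `1 ≤ k` is
    -- needed here.
    _ ≤ (m * k + 1) * (m * k + 1) ^ (d * (m + 1) * m) := by
        gcongr
        nlinarith
    _ = _ := by rw [pow_succ, mul_comm]

/-! ### Number of rounds and reduction to the iterates -/

/-- The total budget for the error decreases, which limits the number of rounds.
`integral_mono_of_nonneg` asks for integrability of the constant bound only, so `F` need not be
measurable. -/
theorem sqError_mem_Icc {X : Type*} [MeasurableSpace X] (D : Measure (Example X))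
    [IsProbabilityMeasure D] {F : X → ℝ} (hF : ∀ x, F x ∈ Set.Icc (0 : ℝ) 1) :
    sqError D F ∈ Set.Icc (0 : ℝ) 1 := by
  refine ⟨integral_nonneg fun z => sq_nonneg _, ?_⟩
  have : sqError D F ≤ ∫ _, (1 : ℝ) ∂D := by
    refine integral_mono_of_nonneg (Filter.Eventually.of_forall fun z => sq_nonneg _)
      (integrable_const _) (Filter.Eventually.of_forall fun z => ?_)
    have h1 := hF z.1
    have h2 := z.2.2
    change ((z.2 : ℝ) - F z.1) ^ 2 ≤ 1
    rw [sq_le_one_iff_abs_le_one]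
    exact abs_le.2 ⟨by linarith [h1.2, h2.1], by linarith [h1.1, h2.2]⟩
  simpa using this

/-- Every output of LSBoost arises after at most `2B/α` rounds. -/
theorem exists_eq_boostIter_of_mem_boostClass {Θ X : Type*} [MeasurableSpace X] [Nonempty Θ]
    (g : Θ → X → ℝ) {A : Measure (Example X) → X → ℝ} {f : X → ℝ} {α B : ℝ} (hα : 0 < α)
    (hB : 0 < B) {q : X → ℝ} (hq : q ∈ boostClass (Set.range g) A f α B) :
    ∃ (T : ℕ) (θ : ℕ → ℕ → Θ), (T : ℝ) ≤ 2 * B / α ∧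
      q = boostIter ⌈2 * B / α⌉₊ f (fun s k => g (θ s k)) T := by
  classical
  obtain ⟨D, hD, F, T, h0, hround, hdec, -, rfl⟩ := hq
  set m := ⌈2 * B / α⌉₊
  have hex : ∀ t, ∃ θ : ℕ → Θ, t ≤ T → ∀ x, F (t + 1) x = roundGrid m
      (∑ k ∈ Finset.range (m + 1), Set.indicator {x' | F t x' = (k : ℝ) / m} (g (θ k)) x) := by
    intro t
    by_cases ht : t ≤ T
    · obtain ⟨h, hH, -, hF⟩ := hround t ht
      choose! θ hθ using hH
      refine ⟨θ, fun _ x => ?_⟩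
      rw [hF]
      congr 1
      refine Finset.sum_congr rfl fun k hk => ?_
      rw [hθ k (Nat.lt_succ_iff.1 (Finset.mem_range.1 hk))]
    · exact ⟨fun _ => Classical.arbitrary Θ, fun h => absurd h ht⟩
  choose θ hθ using hex
  have hF : ∀ t ≤ T, F t = boostIter m f (fun s k => g (θ s k)) t := by
    intro t
    induction t with
    | zero => exact fun _ => funext h0
    | succ t ih =>
      intro ht
      have ht' : t ≤ T := by omega
      funext x
      rw [hθ t ht' x, ih ht']
      rfl
  have h01 : ∀ t ≤ T, sqError D (F t) ∈ Set.Icc (0 : ℝ) 1 := fun t ht =>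
    sqError_mem_Icc D fun x => by rw [hF t ht]; exact boostIter_mem_Icc _ _ _ _ _
  have htel : ∀ t ≤ T, t * (α / (2 * B)) ≤ sqError D (F 0) - sqError D (F t) := by
    intro t
    induction t with
    | zero => simp
    | succ t ih =>
      intro ht
      have h1 := ih (by omega)
      have h2 := hdec t (by omega)
      push_cast
      linarith
  refine ⟨T, θ, ?_, hF T le_rfl⟩
  have h1 := htel T le_rfl
  have h2 := (h01 0 (Nat.zero_le _)).2
  have h3 := (h01 T le_rfl).1
  rw [le_div_iff₀ hα]
  have h4 : T * (α / (2 * B)) ≤ 1 := by linarith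
  rw [← mul_div_assoc, div_le_one (by positivity)] at h4
  exact h4

/-- Uniform convergence of the squared error over any class contained in a permissible class of
`[0, 1]`-valued models of polynomial growth. -/
theorem measure_le_iSup_sqError_le {Θ X : Type*} [MeasurableSpace Θ] [StandardBorelSpace Θ]
    [MeasurableSpace X] (M : Θ → X → ℝ) (hM : Measurable fun p : Θ × X => M p.1 p.2)
    (hM01 : ∀ θ x, M θ x ∈ Set.Icc (0 : ℝ) 1) {a V : ℕ} (ha : 1 ≤ a) (hV : 1 ≤ V)
    (hgr : ∀ k : ℕ, 1 ≤ k → ∀ x : Fin k → X,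
      (Set.range fun θ j => M θ (x j)).encard ≤ ((a * k + 1) ^ V : ℕ))
    {𝒢 : Set (X → ℝ)} (h𝒢 : 𝒢 ⊆ Set.range M)
    (D : Measure (Example X)) [IsProbabilityMeasure D] {n : ℕ} {ε δ : ℝ}
    (hε : 0 < ε) (hδ : 0 < δ) (hδ1 : δ ≤ 1)
    (hn : 8192 * (2 * (V * Real.log (4 * a * V)) + Real.log (1 / δ) + 3) ≤ n * ε ^ 2) :
    (Measure.pi fun _ : Fin n => D)
      {S | ε ≤ ⨆ h : 𝒢, |sqError D h.1 - empiricalSqError S h.1|} ≤ ENNReal.ofReal δ := by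
  refine (measure_mono ?_).trans (measure_exists_lt_abs_integral_sub_mean_le
    (fun θ (z : Example X) => ((z.2 : ℝ) - M θ z.1) ^ 2) ?_ ?_ ha hV ?_ D hε hδ hδ1 hn)
  · intro S (hS : ε ≤ ⨆ h : 𝒢, |sqError D h.1 - empiricalSqError S h.1|)
    rcases isEmpty_or_nonempty 𝒢 with h | h
    · rw [Real.iSup_of_isEmpty] at hS
      exact absurd hS (not_le.2 hε)
    -- The supremum need not be attained; passing from `ε` to `ε / 2` yields a model with a strict
    -- deviation.
    · obtain ⟨⟨q, hq⟩, hlt⟩ := exists_lt_of_lt_ciSup (show ε / 2 < _ from (half_lt_self hε).trans_le hS)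
      obtain ⟨θ, rfl⟩ := h𝒢 hq
      exact ⟨θ, hlt⟩
  · have h1 : Measurable fun p : Θ × Example X => M p.1 p.2.1 :=
      hM.comp (f := fun p : Θ × Example X => (p.1, p.2.1)) (by fun_prop)
    have h2 : Measurable fun p : Θ × Example X => (p.2.2 : ℝ) := by fun_prop
    exact (h2.sub h1).pow_const 2
  · intro θ z
    refine ⟨sq_nonneg _, ?_⟩
    have h1 := hM01 θ z.1
    have h2 := z.2.2
    rw [sq_le_one_iff_abs_le_one]
    exact abs_le.2 ⟨by linarith [h1.2, h2.1], by linarith [h1.1, h2.2]⟩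
  · intro k hk ζ
    -- At fixed examples the loss pattern is a function of the model's pattern, so there are no more
    -- loss patterns than model patterns.
    have e : (Set.range fun θ j => (((ζ j).2 : ℝ) - M θ (ζ j).1) ^ 2)
        = (fun v j => (((ζ j).2 : ℝ) - v j) ^ 2) '' Set.range fun θ j => M θ (ζ j).1 := by
      rw [← Set.range_comp]
      rfl
    rw [e]
    exact (Set.encard_image_le _ _).trans (hgr k hk fun j => (ζ j).1)

theorem HasPseudodimension.nonempty {X : Type*} {H : Set (X → ℝ)} {d : ℕ}
    (hd : HasPseudodimension H d) : H.Nonempty := by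
  obtain ⟨x, y, hxy⟩ := hd.1
  obtain ⟨h, hH, -⟩ := hxy fun _ => true
  exact ⟨h, hH⟩

/-- A class of pseudodimension `0` has only one element. -/
theorem HasPseudodimension.subsingleton {X : Type*} {H : Set (X → ℝ)}
    (hd : HasPseudodimension H 0) : H.Subsingleton := by
  have key : ∀ h ∈ H, ∀ h' ∈ H, ∀ x, h' x ≤ h x := by
    intro h hH h' hH' x
    by_contra hlt
    -- If `h x < h' x`, the single point `x` with target `h x` is pseudo-shattered.
    have : 1 ≤ 0 := hd.2 ⟨fun _ => x, fun _ => h x, fun b => by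
      cases hb : b 0 with
      | true => exact ⟨h', hH', fun i => by rw [Fin.eq_zero i, hb]; simpa using hlt⟩
      | false => exact ⟨h, hH, fun i => by rw [Fin.eq_zero i, hb]; simp⟩⟩
    omega
  exact fun h hH h' hH' => funext fun x => le_antisymm (key h' hH' h hH x) (key h hH h' hH' x)

/-- The case in which LSBoost has at most two possible outputs. -/
theorem boostClass_subset_of_degenerate {Θ X : Type*} [MeasurableSpace X] (g : Θ → X → ℝ) {d : ℕ}
    (hd : HasPseudodimension (Set.range g) d) (A : Measure (Example X) → X → ℝ) (f : X → ℝ)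
    {α B : ℝ} (hα : 0 < α) (hB : 0 < B) (hdeg : d = 0 ∨ 2 * B < α) (θ₀ : Θ) :
    boostClass (Set.range g) A f α B ⊆ Set.range fun b : Bool =>
      bif b then fun x => roundGrid ⌈2 * B / α⌉₊ (g θ₀ x)
      else fun x => roundGrid ⌈2 * B / α⌉₊ (f x) := by
  intro q hq
  have : Nonempty Θ := ⟨θ₀⟩
  have hm : 0 < ⌈2 * B / α⌉₊ := Nat.ceil_pos.2 (by positivity)
  obtain ⟨T, θ, hT, rfl⟩ := exists_eq_boostIter_of_mem_boostClass g hα hB hq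
  cases T with
  | zero => exact ⟨false, rfl⟩
  | succ t =>
    rcases hdeg with rfl | hlt
    · refine ⟨true, funext fun x => ?_⟩
      obtain ⟨k, hk, e⟩ := exists_boostIter_eq ⌈2 * B / α⌉₊ f (fun s k => g (θ s k)) t x
      rw [boostIter_succ hm f _ hk e, hd.subsingleton ⟨θ t k, rfl⟩ ⟨θ₀, rfl⟩]
      rfl
    · rw [le_div_iff₀ hα] at hT
      push_cast at hT
      nlinarith [(Nat.cast_nonneg t : (0 : ℝ) ≤ t)]

/-! ### Sample size arithmetic -/

/-- The sample size of the theorem suffices when LSBoost has at most two possible outputs. -/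
theorem sample_size_of_two {N l : ℝ} (hl : Real.log 2 ≤ l) (hN : 40960000 * l ≤ N) :
    8192 * (2 * (((1 : ℕ) : ℝ) * Real.log (4 * ((1 : ℕ) : ℝ) * ((1 : ℕ) : ℝ))) + l + 3) ≤ N := by
  have h4 : Real.log 4 = 2 * Real.log 2 := by
    rw [show (4 : ℝ) = 2 ^ 2 by norm_num, Real.log_pow]
    norm_num
  have := Real.log_two_gt_d9
  simp only [Nat.cast_one, mul_one, one_mul]
  rw [h4]
  linarith

/-- The sample size of the theorem suffices in general, with `b = B/α` and `l = log (1/δ)`. -/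
theorem sample_size_of_general {N l b : ℝ} {d m : ℕ} (hd : 1 ≤ d) (hm : 1 ≤ m) (hb : 1 / 2 ≤ b)
    (hmb : (m : ℝ) ≤ 2 * b + 1) (hl0 : 0 ≤ l) (hl : Real.log 2 ≤ l ∨ 2 ≤ d * b)
    (hN : 40960000 * (d * b ^ 3 * Real.log (d * b) ^ 2 + l) ≤ N) :
    8192 * (2 * (((d * (m + 1) * m + 1 : ℕ) : ℝ)
      * Real.log (4 * m * ((d * (m + 1) * m + 1 : ℕ) : ℝ))) + l + 3) ≤ N := by
  have hd' : (1 : ℝ) ≤ d := by exact_mod_cast hd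
  have hm' : (1 : ℝ) ≤ m := by exact_mod_cast hm
  have hm4 : (m : ℝ) ≤ 4 * b := by linarith
  have hlog2 := Real.log_two_gt_d9
  set V : ℝ := ((d * (m + 1) * m + 1 : ℕ) : ℝ) with hV
  have hdm : (1 : ℝ) ≤ d * m ^ 2 := by nlinarith
  have hV1 : V ≤ 3 * (d * m ^ 2) := by
    rw [hV]
    push_cast
    nlinarith [mul_le_mul_of_nonneg_left hm' (show (0 : ℝ) ≤ d * m by positivity)]
  have hV0 : 1 ≤ V := by
    rw [hV]
    push_cast
    nlinarith [show (0 : ℝ) ≤ d * (m + 1) * m by positivity]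
  have hV48 : V ≤ 48 * (d * b ^ 2) := by
    calc V ≤ 3 * (d * m ^ 2) := hV1
      _ ≤ 3 * (d * (4 * b) ^ 2) := by gcongr
      _ = _ := by ring
  have harg : 4 * m * V ≤ 768 * (d * b ^ 3) := by
    calc 4 * m * V ≤ 4 * (4 * b) * (48 * (d * b ^ 2)) := by gcongr
      _ = _ := by ring
  have harg1 : 0 < 4 * m * V := by positivity
  set w : ℝ := d * b with hw
  have hbw : b ≤ w := by nlinarith
  have hlogV : 0 ≤ Real.log (4 * m * V) := Real.log_nonneg (by nlinarith)
  by_cases hw2 : 2 ≤ w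
  · set y := Real.log w with hy
    have hylog : Real.log 2 ≤ y := Real.log_le_log two_pos hw2
    have h1 : Real.log (4 * m * V) ≤ 13 * y := by
      have h2 : 4 * m * V ≤ w ^ 13 := by
        calc 4 * m * V ≤ 768 * (d * b ^ 3) := harg
          _ = 768 * (w * b ^ 2) := by rw [hw]; ring
          _ ≤ 2 ^ 10 * (w * w ^ 2) := by gcongr; norm_num
          _ ≤ w ^ 10 * (w * w ^ 2) := by gcongr
          _ = w ^ 13 := by ring
      have := Real.log_le_log harg1 h2
      rw [Real.log_pow] at this
      exact_mod_cast this
    have hP : V * Real.log (4 * m * V) ≤ 2000 * (d * b ^ 3 * y ^ 2) := by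
      have hy0 : 0 < y := by linarith
      -- Since `b ≥ 1/2` and `y ≥ log 2 > 2/3`, the spare factors `b` and `y` of the sample size
      -- cost only a constant.
      have h3 : (1 : ℝ) ≤ 2 * b * (y * (3 / 2)) := by nlinarith
      calc V * Real.log (4 * m * V) ≤ 48 * (d * b ^ 2) * (13 * y) := by gcongr
        _ = 624 * (d * b ^ 2 * y) * 1 := by ring
        _ ≤ 624 * (d * b ^ 2 * y) * (2 * b * (y * (3 / 2))) := by gcongr
        _ = 1872 * (d * b ^ 3 * y ^ 2) := by ring
        _ ≤ _ := by gcongr; norm_num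
    have h3 : 3 ≤ 15 * (d * b ^ 3 * y ^ 2) := by
      have h5 : (2 : ℝ) * (1 / 2) ^ 2 * (2 / 3) ^ 2 ≤ w * b ^ 2 * y ^ 2 := by
        gcongr
        linarith
      have e : d * b ^ 3 * y ^ 2 = w * b ^ 2 * y ^ 2 := by rw [hw]; ring
      rw [e]
      linarith
    linarith
  -- For `d * b < 2` the logarithm may vanish and the first term gives nothing. But then `V` and `m`
  -- are bounded by constants, and `l ≥ log 2` absorbs everything.
  · have hl' : Real.log 2 ≤ l := hl.resolve_right hw2
    rw [not_le] at hw2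
    have hb2 : b < 2 := by linarith
    have hw0 : 0 ≤ w := by positivity
    have hb0 : 0 ≤ b := by linarith
    have h1 : Real.log (4 * m * V) ≤ 13 * Real.log 2 := by
      have h2 : 4 * m * V ≤ 2 ^ 13 := by
        calc 4 * m * V ≤ 768 * (w * b ^ 2) := by rw [hw]; linarith
          _ ≤ 768 * (2 * 2 ^ 2) := by gcongr
          _ ≤ _ := by norm_num
      have := Real.log_le_log harg1 h2
      rw [Real.log_pow] at this
      exact_mod_cast this
    have hV2 : V ≤ 192 := by
      calc V ≤ 48 * (w * b) := by rw [hw]; linarith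
        _ ≤ 48 * (2 * 2) := by gcongr
        _ = _ := by norm_num
    have hVl : V * Real.log (4 * m * V) ≤ 192 * (13 * Real.log 2) := by
      gcongr
    have hnn : 0 ≤ d * b ^ 3 * Real.log w ^ 2 := by positivity
    linarith

end LSBoost

end

/-! ### The theorem -/

/-- Uniform convergence of the squared error over the class of models that LSBoost can output.
Errors of such models lie in `[0, 1]`, so the supremum below is over a bounded set. -/
theorem mainTheorem10 :
    ∃ C : ℝ, 0 < C ∧
      ∀ (X : Type*) [MeasurableSpace X] (H : Set (X → ℝ)) (_ : LSBoost.IsPermissible H)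
        (d : ℕ) (_ : LSBoost.HasPseudodimension H d)
        (A : Measure (LSBoost.Example X) → X → ℝ) (_ : LSBoost.IsRegressionOracle H A)
        (f : X → ℝ) (_ : Measurable f)
        (ε δ α B : ℝ) (_ : 0 < ε) (_ : 0 < δ) (_ : 0 < α) (_ : 0 < B)
        (_ : δ ≤ 1 / 2 ∨ (α ≤ 2 * B ∧ 2 * α ≤ d * B))
        (D : Measure (LSBoost.Example X)) [IsProbabilityMeasure D] (n : ℕ)
        (_ : C * (d * B ^ 3 * Real.log (d * B / α) ^ 2 / (α ^ 3 * ε ^ 2)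
              + Real.log (1 / δ) / ε ^ 2) ≤ n),
        (Measure.pi fun _ : Fin n => D)
            {S | ε ≤ ⨆ h : LSBoost.boostClass H A f α B,
              |LSBoost.sqError D h.1 - LSBoost.empiricalSqError S h.1|}
          ≤ ENNReal.ofReal δ := by
  -- This is `8192 * 5000`. The tightest case is `d * b < 2` in `sample_size_of_general`, where `2 *
  -- 192 * 13 = 4992` multiples of `log 2` have to be covered.
  refine ⟨40960000, by norm_num, ?_⟩
  intro X _ H hH d hd A _ f hf ε δ α B hε hδ hα hB hcase D _ n hn
  rcases lt_or_ge 1 δ with hδ1 | hδ1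
  · exact prob_le_one.trans (ENNReal.one_le_ofReal.2 hδ1.le)
  obtain ⟨Θ, _, _, g, hg, rfl⟩ := hH
  obtain ⟨_, θ₀, _⟩ := hd.nonempty
  have : Nonempty Θ := ⟨θ₀⟩
  set m := ⌈2 * B / α⌉₊ with hmdef
  have hm : 0 < m := Nat.ceil_pos.2 (by positivity)
  have hl0 : 0 ≤ Real.log (1 / δ) := Real.log_nonneg (by rw [le_div_iff₀ hδ]; linarith)
  have hl2 : δ ≤ 1 / 2 → Real.log 2 ≤ Real.log (1 / δ) := fun h =>
    Real.log_le_log two_pos (by rw [le_div_iff₀ hδ]; linarith)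
  have hN : 40960000 * (d * (B / α) ^ 3 * Real.log (d * (B / α)) ^ 2 + Real.log (1 / δ))
      ≤ n * ε ^ 2 := by
    rw [← div_le_iff₀ (by positivity)]
    refine le_trans (le_of_eq ?_) hn
    rw [mul_div_assoc (d : ℝ) B α]
    field_simp
  -- Here the first term of the sample size may be zero or tiny, but at most two models are
  -- possible. The second alternative of `hcase` is excluded, so `δ ≤ 1/2` and the term `log (1 /
  -- δ)` suffices.
  by_cases hdeg : d = 0 ∨ 2 * B < α
  · have hδ2 : δ ≤ 1 / 2 := by
      refine hcase.resolve_right fun ⟨h1, h2⟩ => ?_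
      rcases hdeg with rfl | h
      · rw [Nat.cast_zero, zero_mul] at h2
        linarith
      · linarith
    refine LSBoost.measure_le_iSup_sqError_le (a := 1) (V := 1) _ ?_ ?_ le_rfl le_rfl ?_
      (LSBoost.boostClass_subset_of_degenerate g hd A f hα hB hdeg θ₀) D hε hδ hδ1
      (LSBoost.sample_size_of_two (hl2 hδ2) (le_trans ?_ hN))
    · refine measurable_from_prod_countable_right fun b => ?_
      cases b
      · exact (LSBoost.measurable_roundGrid m).comp hf
      · exact (LSBoost.measurable_roundGrid m).comp (hg.comp measurable_prodMk_left)
    · intro b x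
      cases b
      · exact LSBoost.boostIter_mem_Icc m f (fun _ _ => f) 0 x
      · exact LSBoost.boostIter_mem_Icc m (g θ₀) (fun _ _ => f) 0 x
    · intro k hk x
      rw [← Set.image_univ]
      refine (Set.encard_image_le _ _).trans ?_
      rw [Set.encard_univ, ENat.card_eq_coe_fintype_card, Fintype.card_bool]
      exact Nat.cast_le.2 (by rw [one_mul, pow_one]; omega)
    · have : 0 ≤ d * (B / α) ^ 3 * Real.log (d * (B / α)) ^ 2 := by positivity
      linarith
  · rw [not_or, not_lt] at hdeg
    have hb : 1 / 2 ≤ B / α := by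
      rw [le_div_iff₀ hα]
      linarith
    refine LSBoost.measure_le_iSup_sqError_le
      (fun (p : Fin (m + 1) × (ℕ → ℕ → Θ)) => LSBoost.boostIter m f (fun s j => g (p.2 s j)) p.1)
      ?_ (fun p x => LSBoost.boostIter_mem_Icc m f _ _ x) (V := d * (m + 1) * m + 1) hm
      (Nat.le_add_left _ _) (fun k hk x => LSBoost.encard_range_boostIter_le g hd hm f hk x) ?_
      D hε hδ hδ1 (LSBoost.sample_size_of_general (Nat.one_le_iff_ne_zero.2 hdeg.1) hm hb ?_ hl0 ?_ hN)
    · have h1 : Measurable fun p : Fin (m + 1) × ((ℕ → ℕ → Θ) × X) =>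
          LSBoost.boostIter m f (fun s j => g (p.2.1 s j)) p.1 p.2.2 :=
        measurable_from_prod_countable_right fun t => LSBoost.measurable_boostIter hg m hf t
      exact h1.comp (f := fun p : (Fin (m + 1) × (ℕ → ℕ → Θ)) × X => (p.1.1, (p.1.2, p.2)))
        (by fun_prop)
    · intro q hq
      obtain ⟨T, θ, hT, rfl⟩ := LSBoost.exists_eq_boostIter_of_mem_boostClass g hα hB hq
      have hTm : T < m + 1 := by
        rw [Nat.lt_succ_iff]
        exact_mod_cast hT.trans (Nat.le_ceil _)
      exact ⟨(⟨T, hTm⟩, θ), rfl⟩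
    · rw [← mul_div_assoc]
      exact (Nat.ceil_lt_add_one (by positivity)).le
    · refine hcase.imp hl2 fun h => ?_
      rw [← mul_div_assoc, le_div_iff₀ hα]
      exact h.2
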